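/- **Setting.** Let $Y$ be a (paracompact, Hausdorff) $C^\infty$ $n$-manifold with corners. A finite open covering $\mathfrak U=\{U_j\}_{j\in J}$ of $Y$ is *regular* if, near each $p\in Y$, every $U_j$ with $p\in\partial U_j$ is the positive side $\{f_j>0\}$ of a smooth function, and the hypersurfaces $\{f_j=0\}$ with $p\in\partial U_j$ together with the boundary faces of $Y$ through $p$ intersect transversely at $p$ (their differentials at $p$ are linearly independent); here $\partial U_j$ is the topological boundary in $Y$. For $A\subset J$ let $Y_A$ be the closure of the set of points that lie in $U_j$ exactly for the $j\in A$. The *partition $\mathcal P_{\mathfrak U}=\{Y_i\}_{i\in I}$ associated to $\mathfrak U$* consists of the connected components of all the $Y_A$; if $Y_i$ is a component of $Y_A$, put $J(i)=A$. A partition of $Y$ into connected blocks that cover $Y$ and have disjoint interiors is *regular* if near each point $p$ it is diffeomorphic to the partition of a neighbourhood of the origin of $[0,\infty)^l\times\mathbb R^k\times\mathbb R^{n-l-k}$ by the $2^k$ coordinate quadrants of $\mathbb R^k$ (distinct quadrants belonging to distinct blocks). The points with a given $k$ form the codimension-$k$ stratum; the closures of its connected components are the codimension-$k$ *facets*. A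 *$C^\infty$ $\mathbb C$-vector-bundle settlement* over a regular partition $\{Y_i\}$ consists of bundles $F_i$ over the blocks (each restricted from a $C^\infty$ bundle over an open neighbourhood of $Y_i$) and, for each facet $Z$ of codimension $k\ge1$, of a quiver $Q_Z$ whose vertices are the blocks containing $Z$, with a vector bundle embedding $h_{Z,ij}:F_i|_Z\to F_j|_Z$ for each edge $i\to j$ (a *clutching map*), which extends to a $C^\infty$ bundle embedding over an open neighbourhood of $Z$, such that: 1. for $k=1$, $Q_Z$ consists of exactly one edge between the two blocks around $Z$; 2. for $k\ge2$, $Q_Z$ contains the preliminary quiver $Q'_Z$ formed by the restrictions to $Z$ of the clutching maps along all codimension-$(k-1)$ facets containing $Z$; $Q_Z$ is saturated (some vertex is the end of an edge-path from each vertex); and $Q_Z=Q'_Z$ if $Q'_Z$ is already saturated; 3. the composites of clutching maps along any two edge-paths in $Q_Z$ with the same ends agree (and are the identity for loops). **Statement.** Let $\mathfrak U$ be a regular finite open covering of $Y$. For each $j\in J$ let $H_j$ be a $C^\infty$ $\mathbb C$-vector bundle over $\overline{U_j}$ (restricted from a $C^\infty$ bundle over an open neighbourhood of $\overline{U_j}$),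 with a $C^\infty$ section $s_j$ that vanishes nowhere on $\overline{U_j}\cap\bigcup_{j'\ne j}\overline{U_{j'}}$. Put $F_i=\bigotimes_{j\in J(i)}H_j|_{Y_i}$. Along a codimension-one facet $Z\subset Y_i\cap Y_{i'}$ with $J(i')=J(i)\cup\{j\}$, $j\notin J(i)$, let $h_{Z,ii'}:F_i|_Z\to F_{i'}|_Z$ be the map that inserts $s_j$ as the $j$-th tensor factor; along the other facets take the restrictions of these maps. Then: 1. $\mathcal P_{\mathfrak U}$ is a regular partition, and these data form a $C^\infty$ $\mathbb C$-vector-bundle settlement over it (the *local tensorial system*). 2. Each codimension-one facet $Z$ lies in $\partial U_j$ for exactly one $j$, and its clutching map goes from the block $Y_i\subset Y-U_j$ to the block $Y_{i'}$ whose interior lies in $U_j$, where $J(i')=J(i)\cup\{j\}$, $j\notin J(i)$. 3. For each codimension-$k$ facet $Z$, the set $K=\{j: Z\subset\partial U_j\}$ has exactly $k$ elements, and $Q_Z$ is the $1$-skeleton of the directed $k$-cube: there are $J_0\subset J\setminus K$ and a bijection $A\mapsto i_A$ from the subsets of $K$ onto the blocks containing $Z$ with $J(i_A)=J_0\cup A$,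 and there is an edge $i_A\to i_B$ exactly if $B=A\cup\{j\}$ for some $j\in K\setminus A$. So $Q_Z$ has a unique source and a unique sink, and every vertex lies on an edge-path from the source to the sink. 4. $Q_Z$ is saturated for every facet $Z$; if $k\ge2$, then $Q'_Z$ is already saturated and $Q_Z=Q'_Z$ (no clutching maps are added). 5. For each edge-path in $Q_Z$ from $i$ to $i'$ one has $J(i)\subset J(i')$, and the composite of the clutching maps along the path is the natural map $F_i|_Z\to F_{i'}|_Z$ that keeps the factors in $J(i)$ and inserts $s_j$ for $j\in J(i')\setminus J(i)$. Hence it depends only on the ends of the path, and all consistency conditions hold automatically. -/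

import Mathlib

open Set Topology TopologicalSpace TensorProduct
open scoped Manifold ContDiff

universe u v w

/-- The model with corners of `n`-manifolds with corners: charts take values in `[0,∞)ⁿ`. -/
noncomputable abbrev cornerModel (n : ℕ) :
    ModelWithCorners ℝ (EuclideanSpace ℝ (Fin n)) (EuclideanQuadrant n) :=
  modelWithCornersEuclideanQuadrant n

/-! ### Smooth complex vector bundles over open subsets, described by smooth local frames -/

/-- A local frame of a family of complex vector spaces `E y`, `y ∈ Y`, over the open set `dom`:
finitely many sections that form a basis of `E y` at each point `y` of `dom`.
Only the values over `dom` matter. -/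
structure LocalFrame {Y : Type u} [TopologicalSpace Y] (E : Y → Type v)
    [∀ y, AddCommGroup (E y)] [∀ y, Module ℂ (E y)] where
  dom : Opens Y
  idx : Type
  [fin : Fintype idx]
  vec : idx → ∀ y, E y
  indep : ∀ y ∈ dom, LinearIndependent ℂ (fun a => vec a y)
  span : ∀ y ∈ dom, ⊤ ≤ Submodule.span ℂ (Set.range fun a => vec a y)

attribute [instance] LocalFrame.fin

/-- A `C^∞` complex vector bundle over an open subset `base` of the manifold with corners `Y`
(the rank is locally constant): a family of vector spaces with a collection of local frames that
cover `base` and are related to each other by smooth change-of-frame matrices. A local frame is the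
same as a local trivialization. The fibres over points outside `base` carry no information. -/
structure SmoothBundle (n : ℕ) (Y : Type u) [TopologicalSpace Y]
    [ChartedSpace (EuclideanQuadrant n) Y] where
  base : Opens Y
  fiber : Y → Type v
  [addCommGroup : ∀ y, AddCommGroup (fiber y)]
  [module : ∀ y, Module ℂ (fiber y)]
  frames : Set (LocalFrame fiber)
  frames_le : ∀ e ∈ frames, e.dom ≤ base
  cover : ∀ y ∈ base, ∃ e ∈ frames, y ∈ e.dom
  compat : ∀ e ∈ frames, ∀ e' ∈ frames, ∃ g : e.idx → e'.idx → Y → ℂ,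
    (∀ a b, ContMDiffOn (cornerModel n) 𝓘(ℝ, ℂ) ∞ (g a b) (e.dom ∩ e'.dom)) ∧
    ∀ y ∈ (e.dom ∩ e'.dom : Set Y), ∀ a, e.vec a y = ∑ b, g a b y • e'.vec b y

attribute [instance] SmoothBundle.addCommGroup SmoothBundle.module

namespace SmoothBundle

variable {n : ℕ} {Y : Type u} [TopologicalSpace Y] [ChartedSpace (EuclideanQuadrant n) Y]

/-- `t` is a `C^∞` section of `E` over the open set `V`: its coordinates in the frames of `E` are
smooth functions. -/
def IsSmoothSection (E : SmoothBundle.{u, v} n Y) (V : Opens Y) (t : ∀ y, E.fiber y) : Prop :=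
  V ≤ E.base ∧ ∀ e ∈ E.frames, ∃ c : e.idx → Y → ℂ,
    (∀ a, ContMDiffOn (cornerModel n) 𝓘(ℝ, ℂ) ∞ (c a) (V ∩ e.dom)) ∧
    ∀ y ∈ (V ∩ e.dom : Set Y), t y = ∑ a, c a y • e.vec a y

/-- `g` is a `C^∞` vector bundle embedding `E|_V → E'|_V` over the open set `V`: fibrewise linear
and injective, and sending the frames of `E` to smooth sections of `E'`. -/
def IsSmoothEmbedding (E : SmoothBundle.{u, v} n Y) (E' : SmoothBundle.{u, w} n Y) (V : Opens Y)
    (g : ∀ y, E.fiber y →ₗ[ℂ] E'.fiber y) : Prop :=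
  V ≤ E.base ∧ V ≤ E'.base ∧ (∀ y ∈ V, Function.Injective (g y)) ∧
    ∀ e ∈ E.frames, ∀ a, E'.IsSmoothSection (V ⊓ e.dom) (fun y => g y (e.vec a y))

/-- `h : E|_Z → E'|_Z` is a vector bundle embedding that is smooth around `Z`: it is the restriction
of a `C^∞` vector bundle embedding over an open neighbourhood of `Z`. Only the maps `h y` with
`y ∈ Z` matter. -/
def IsEmbeddingAround (E : SmoothBundle.{u, v} n Y) (E' : SmoothBundle.{u, w} n Y) (Z : Set Y)
    (h : ∀ y, E.fiber y →ₗ[ℂ] E'.fiber y) : Prop :=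
  ∃ V : Opens Y, Z ⊆ V ∧ ∃ g : ∀ y, E.fiber y →ₗ[ℂ] E'.fiber y,
    E.IsSmoothEmbedding E' V g ∧ ∀ y ∈ Z, g y = h y

end SmoothBundle

/-! ### Tensor products of bundles -/

/-- The tensor products of the members of local frames of `E j`, `j ∈ A`. -/
noncomputable def LocalFrame.tensor {Y : Type u} [TopologicalSpace Y] {J : Type}
    [DecidableEq J] {E : J → Y → Type v} [∀ j y, AddCommGroup (E j y)]
    [∀ j y, Module ℂ (E j y)] (A : Finset J) (e : ∀ j : A, LocalFrame (E j)) :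
    LocalFrame (fun y => ⨂[ℂ] j : A, E j y) where
  dom := Finset.univ.inf fun j : A => (e j).dom
  idx := ∀ j : A, (e j).idx
  vec a y := ⨂ₜ[ℂ] j : A, (e j).vec (a j) y
  indep y hy := by
    have hy' : ∀ j : A, y ∈ (e j).dom := fun j =>
      (Finset.inf_le (f := fun j : A => (e j).dom) (Finset.mem_univ j)) hy
    have h := (Basis.piTensorProduct fun j : A =>
      Module.Basis.mk ((e j).indep y (hy' j)) ((e j).span y (hy' j))).linearIndependent
    have hb : (fun a : ∀ j : A, (e j).idx => ⨂ₜ[ℂ] j : A, (e j).vec (a j) y) =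
        Basis.piTensorProduct fun j : A =>
          Module.Basis.mk ((e j).indep y (hy' j)) ((e j).span y (hy' j)) := by
      funext a
      simp
    rw [hb]
    exact h
  span y hy := by
    have hy' : ∀ j : A, y ∈ (e j).dom := fun j =>
      (Finset.inf_le (f := fun j : A => (e j).dom) (Finset.mem_univ j)) hy
    have := (Basis.piTensorProduct fun j : A =>
      Module.Basis.mk ((e j).indep y (hy' j)) ((e j).span y (hy' j))).span_eq
    rw [← this]
    refine Submodule.span_mono (Set.range_subset_range_iff_exists_comp.2 ⟨id, ?_⟩)
    funext a
    simp

/-- The tensor product `⨂_{j ∈ A} H j`, a bundle over the intersection of the bases of the factors;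
its frames are the tensor products of frames of the factors. -/
noncomputable def SmoothBundle.tensor {n : ℕ} {Y : Type u} [TopologicalSpace Y]
    [ChartedSpace (EuclideanQuadrant n) Y] {J : Type} [DecidableEq J]
    (H : J → SmoothBundle.{u, v} n Y) (A : Finset J) : SmoothBundle.{u, v} n Y where
  base := Finset.univ.inf fun j : A => (H j).base
  fiber y := ⨂[ℂ] j : A, (H j).fiber y
  frames := {f | ∃ e : ∀ j : A, LocalFrame (H j).fiber,
    (∀ j : A, e j ∈ (H j).frames) ∧ f = LocalFrame.tensor (E := fun j => (H j).fiber) A e}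
  frames_le := by
    rintro _ ⟨e, he, rfl⟩
    exact Finset.inf_mono_fun fun j _ => (H j).frames_le _ (he j)
  cover y hy := by
    have hy' : ∀ j : A, y ∈ (H j).base := fun j =>
      (Finset.inf_le (f := fun j : A => (H j).base) (Finset.mem_univ j)) hy
    choose e he hye using fun j : A => (H j).cover y (hy' j)
    refine ⟨_, ⟨e, he, rfl⟩, ?_⟩
    simpa [LocalFrame.tensor, ← SetLike.mem_coe, Opens.coe_finset_inf] using hye
  compat := by
    rintro _ ⟨e, he, rfl⟩ _ ⟨e', he', rfl⟩
    choose g hg hgv using fun j : A => (H j).compat _ (he j) _ (he' j)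
    have hsub : ∀ j : A, ((LocalFrame.tensor (E := fun j => (H j).fiber) A e).dom ∩
        (LocalFrame.tensor (E := fun j => (H j).fiber) A e').dom : Set Y) ⊆
        (e j).dom ∩ (e' j).dom := fun j y hy =>
      ⟨(Finset.inf_le (f := fun j : A => (e j).dom) (Finset.mem_univ j)) hy.1,
        (Finset.inf_le (f := fun j : A => (e' j).dom) (Finset.mem_univ j)) hy.2⟩
    refine ⟨fun a b y => ∏ j : A, g j (a j) (b j) y, fun a b => ?_, fun y hy a => ?_⟩
    · have h0 : ContDiff ℝ ∞ fun x : A → ℂ => ∏ j, x j :=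
        contDiff_prod fun j _ => contDiff_apply ℝ ℂ j
      exact h0.contMDiff.comp_contMDiffOn
        (contMDiffOn_pi_space.2 fun j => (hg j (a j) (b j)).mono (hsub j))
    · classical
      have h1 : ∀ j : A, (e j).vec (a j) y = ∑ b, g j (a j) b y • (e' j).vec b y :=
        fun j => hgv j y (hsub j hy) (a j)
      simp only [LocalFrame.tensor]
      simp_rw [h1, MultilinearMap.map_sum, MultilinearMap.map_smul_univ]
      congr!

/-- For `A ⊆ B` and vectors `s j`, the linear map `⨂_{j ∈ A} M j → ⨂_{j ∈ B} M j` that keeps the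
factors in `A` and inserts `s j` at the factors `j ∈ B \ A`. -/
noncomputable def tensorInsert {J : Type} [DecidableEq J] {M : J → Type v}
    [∀ j, AddCommGroup (M j)] [∀ j, Module ℂ (M j)] {A B : Finset J} (hAB : A ⊆ B)
    (s : ∀ j, M j) : (⨂[ℂ] j : A, M j) →ₗ[ℂ] ⨂[ℂ] j : B, M j :=
  have key : ∀ [DecidableEq A] (m : ∀ j : A, M j) (i : A) (x : M i),
      (fun j : B => Function.updateFinset s A (Function.update m i x) j) =
        Function.update (fun j : B => Function.updateFinset s A m j) (⟨i, hAB i.2⟩ : B) x := by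
    intro _ m i x
    funext j
    by_cases hj : j = (⟨i, hAB i.2⟩ : B)
    · subst hj
      simp [Function.updateFinset]
    · rw [Function.update_of_ne hj]
      by_cases hjA : (j : J) ∈ A
      · have : (⟨j, hjA⟩ : A) ≠ i := by
          rintro rfl
          exact hj rfl
        simp [Function.updateFinset, hjA, Function.update_of_ne this]
      · simp [Function.updateFinset, hjA]
  PiTensorProduct.lift
    { toFun := fun m => ⨂ₜ[ℂ] j : B, Function.updateFinset s A m j
      map_update_add' := by
        intro _ m i x y
        simp only [key, MultilinearMap.map_update_add]
      map_update_smul' := by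
        intro _ m i c x
        simp only [key, MultilinearMap.map_update_smul] }

/-! ### Regular partitions, their strata and facets -/

section Partition

variable (n : ℕ) {Y : Type u} [TopologicalSpace Y] [ChartedSpace (EuclideanQuadrant n) Y]
  {ι : Type w}

/-- Near `p` the collection `block` of subsets of `Y` looks, in a smooth chart `φ` of `Y`, like the
standard partition of `[0,∞)^l × ℝ^k × ℝ^(n-l-k)` near the origin by the `2^k` quadrants of `ℝ^k`.
The `l` boundary coordinates are those that vanish at `p`; `K` is the set of the `k` coordinates
with respect to which the quadrants are formed (measured from their values at `p`). The quadrant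
with sign pattern `σ` belongs to the block `b σ`; distinct quadrants belong to distinct blocks (as a
block is an embedded manifold with corners), and no other block comes near `p`. -/
def IsStandardNear (block : ι → Set Y) (k : ℕ) (p : Y) : Prop :=
  ∃ φ ∈ IsManifold.maximalAtlas (cornerModel n) ∞ Y, p ∈ φ.source ∧
    ∃ (K : Finset (Fin n)) (b : (K → Bool) → ι), K.card = k ∧ Function.Injective b ∧
      (∀ a ∈ K, 0 < (φ p).1 a) ∧
      (∀ σ, block (b σ) ∩ φ.source = {y ∈ φ.source | ∀ a : K,
        if σ a then (φ p).1 a ≤ (φ y).1 a else (φ y).1 a ≤ (φ p).1 a}) ∧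
      ∀ i, (block i ∩ φ.source).Nonempty → i ∈ Set.range b

/-- A regular partition of `Y` by connected blocks with disjoint interiors. (The local form makes
the blocks embedded `n`-manifolds with corners.) -/
structure IsRegularPartition (block : ι → Set Y) : Prop where
  connected : ∀ i, IsConnected (block i)
  iUnion_eq : ⋃ i, block i = Set.univ
  disjoint : Pairwise fun i j => Disjoint (interior (block i)) (interior (block j))
  regular : ∀ p, ∃ k, IsStandardNear n block k p

/-- The codimension-`k` stratum of a partition. -/
def stratum (block : ι → Set Y) (k : ℕ) : Set Y := {p | IsStandardNear n block k p}

/-- The (closed) codimension-`k` facets of a partition: the closures of the connected components of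
the codimension-`k` stratum. -/
def IsFacet (block : ι → Set Y) (k : ℕ) (Z : Set Y) : Prop :=
  ∃ p ∈ stratum n block k, Z = closure (connectedComponentIn (stratum n block k) p)

end Partition

/-! ### Bundle settlements -/

/-- The type of edge-paths from `a` to `b` in the quiver with vertex set `V` and edges `E`. -/
abbrev EdgePath {V : Type w} (E : V → V → Prop) (a b : V) : Type w :=
  @Quiver.Path V ⟨fun x y => PLift (E x y)⟩ a b

/-- A quiver is saturated if it has a vertex that can be reached from each vertex. -/
def IsSaturated {V : Type w} (E : V → V → Prop) : Prop :=
  ∃ v₀ : V, ∀ v : V, Nonempty (EdgePath E v v₀)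

/-- The data of a bundle settlement over the partition `block`: extended bundle blocks `F i` (the
bundle block is the restriction of `F i` to `block i`), and for each facet `Z` some ordered pairs
`(i, j)` of blocks, the edges of the clutching quiver along `Z`, with a clutching map
`h_{Z,ij} : F_i|_Z → F_j|_Z` for each of them. Only the values of clutching maps at points of `Z`
matter. -/
structure SettlementData (n : ℕ) {Y : Type u} [TopologicalSpace Y]
    [ChartedSpace (EuclideanQuadrant n) Y] {ι : Type w} (block : ι → Set Y) where
  F : ι → SmoothBundle.{u, v} n Y
  edge : Set Y → ι → ι → Prop
  clutch : ∀ {Z : Set Y} {i j : ι}, edge Z i j → ∀ y, (F i).fiber y →ₗ[ℂ] (F j).fiber y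

namespace SettlementData

variable {n : ℕ} {Y : Type u} [TopologicalSpace Y] [ChartedSpace (EuclideanQuadrant n) Y]
  {ι : Type w} {block : ι → Set Y} (G : SettlementData.{u, v, w} n block)

/-- The edges of the clutching quiver `Q_Z`; its vertices are the blocks around `Z`. -/
def quiver (Z : Set Y) : {i // Z ⊆ block i} → {i // Z ⊆ block i} → Prop :=
  fun i j => G.edge Z i j

/-- The edges of the preliminary clutching quiver `Q'_Z` of a facet `Z` of codimension `k`: those
coming from the codimension-`(k-1)` facets that contain `Z`. -/
def preQuiver (k : ℕ) (Z : Set Y) : {i // Z ⊆ block i} → {i // Z ⊆ block i} → Prop :=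
  fun i j => ∃ W, IsFacet n block (k - 1) W ∧ Z ⊆ W ∧ G.edge W i j

/-- The composite at `y` of the clutching maps along an edge-path in `Q_Z`. -/
noncomputable def composite (Z : Set Y) (y : Y) {i : {i // Z ⊆ block i}} : ∀ {j : {i // Z ⊆ block i}},
    EdgePath (G.quiver Z) i j → ((G.F i).fiber y →ₗ[ℂ] (G.F j).fiber y) :=
  fun p => @Quiver.Path.rec {i // Z ⊆ block i} ⟨fun i j => PLift (G.quiver Z i j)⟩ i
    (fun j _ => (G.F i).fiber y →ₗ[ℂ] (G.F j).fiber y)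
    LinearMap.id (fun _ e f => G.clutch (PLift.down e) y ∘ₗ f) _ p

/-- The data form a `C^∞` complex vector bundle settlement over a regular partition. -/
structure IsSettlement : Prop where
  regular : IsRegularPartition n block
  /-- `F i` is defined on an open neighbourhood of the block. -/
  block_subset : ∀ i, block i ⊆ (G.F i).base
  /-- Edges of `Q_Z` join blocks that contain `Z`. -/
  edge_subset : ∀ k Z, 1 ≤ k → IsFacet n block k Z → ∀ i j, G.edge Z i j →
    Z ⊆ block i ∧ Z ⊆ block j
  /-- Clutching maps are bundle embeddings that are smooth around `Z`; so their directions go from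
  lower to higher rank, and in the case of equal ranks they are isomorphisms. -/
  embedding : ∀ k Z, 1 ≤ k → IsFacet n block k Z → ∀ i j (h : G.edge Z i j),
    (G.F i).IsEmbeddingAround (G.F j) Z (G.clutch h)
  /-- Along a codimension-one face, exactly one direction is chosen for two distinct blocks. -/
  face : ∀ Z, IsFacet n block 1 Z → (∀ i, ¬ G.edge Z i i) ∧
    ∀ i j, i ≠ j → Z ⊆ block i → Z ⊆ block j → Xor (G.edge Z i j) (G.edge Z j i)
  /-- Clutching maps along facets of codimension `k - 1` restrict to clutching maps along the facets
  of codimension `k` in them. -/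
  restrict : ∀ k Z, 2 ≤ k → IsFacet n block k Z → ∀ W, IsFacet n block (k - 1) W → Z ⊆ W →
    ∀ i j (h : G.edge W i j), ∃ h' : G.edge Z i j, ∀ y ∈ Z, G.clutch h' y = G.clutch h y
  /-- Clutching quivers are saturated. -/
  saturated : ∀ k Z, 2 ≤ k → IsFacet n block k Z → IsSaturated (G.quiver Z)
  /-- No new clutching maps are added if the preliminary quiver is already saturated. -/
  terminal : ∀ k Z, 2 ≤ k → IsFacet n block k Z → IsSaturated (G.preQuiver k Z) →
    G.quiver Z = G.preQuiver k Z
  /-- Consistency of gluing: paths with the same ends have the same composite, which is the identity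
  for loops. -/
  consistent : ∀ k Z, 1 ≤ k → IsFacet n block k Z → ∀ (i j : {i // Z ⊆ block i})
    (p q : EdgePath (G.quiver Z) i j), ∀ y ∈ Z, G.composite Z y p = G.composite Z y q

end SettlementData

/-! ### Regular coverings and their partitions -/

section Covering

variable (n : ℕ) {Y : Type u} [TopologicalSpace Y] [ChartedSpace (EuclideanQuadrant n) Y]
  {J : Type}

/-- The tangent space at `p` of the boundary stratum of `Y` through `p`: the vectors whose
components along the boundary coordinates at `p` vanish (all of `T_p Y` if `p` is interior). -/
noncomputable def stratumTangent (p : Y) : Submodule ℝ (EuclideanSpace ℝ (Fin n)) where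
  carrier := {v | ∀ a, extChartAt (cornerModel n) p p a = 0 → v a = 0}
  zero_mem' := fun a _ => rfl
  add_mem' := fun {v w} hv hw a ha => by simp [hv a ha, hw a ha]
  smul_mem' := fun c v hv a ha => by simp [hv a ha]

/-- The differential at `p` of a function on `Y`, restricted to the tangent space of the boundary
stratum through `p`. -/
noncomputable def stratumDifferential (f : Y → ℝ) (p : Y) : stratumTangent n p →ₗ[ℝ] ℝ :=
  (mfderiv (cornerModel n) 𝓘(ℝ, ℝ) f p : EuclideanSpace ℝ (Fin n) →L[ℝ] ℝ).toLinearMap ∘ₗ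
    (stratumTangent n p).subtype

/-- A regular covering `U j`, `j ∈ J` (with `J` finite) of `Y`: near each point `p`, each of the
`U j` with `p` in its boundary is the positive side of a smooth hypersurface `f j = 0`, and these
hypersurfaces and the boundary faces of `Y` through `p` intersect transversely at `p`: the
differentials of the `f j` and of the boundary coordinates at `p` are linearly independent, i.e. the
differentials of the `f j` are linearly independent on the boundary stratum through `p`.
(So the closures of the `U j` are embedded submanifolds with corners, manifolds with boundary inside
the interior of `Y`, and `U j` is the interior of its closure.) -/
structure IsRegularCovering (U : J → Set Y) : Prop where
  isOpen : ∀ j, IsOpen (U j)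
  iUnion_eq : ⋃ j, U j = Set.univ
  transverse : ∀ p : Y, ∃ (V : Opens Y) (f : {j // p ∈ frontier (U j)} → Y → ℝ), p ∈ V ∧
    (∀ j, ContMDiffOn (cornerModel n) 𝓘(ℝ, ℝ) ∞ (f j) V) ∧
    (∀ j : {j // p ∈ frontier (U j)}, ∀ y ∈ V, y ∈ U j ↔ 0 < f j y) ∧
    LinearIndependent ℝ (fun j => stratumDifferential n (f j) p)

end Covering

section CoveringPartition

variable {Y : Type u} [TopologicalSpace Y] {J : Type} (U : J → Set Y)

/-- `Y_A`: the closure of the set of points that lie in `U j` exactly for the `j ∈ A`. -/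
def cell (A : Finset J) : Set Y := closure {y | ∀ j, y ∈ U j ↔ j ∈ A}

/-- The index set of the partition of `Y` associated to `U`: the connected components of all the
sets `Y_A`. The component `i` belongs to the subset `i.1 = J(i)` of `J`. -/
abbrev BlockIndex : Type u := Σ A : Finset J, ConnectedComponents (cell U A)

/-- The blocks of the partition of `Y` associated to `U`. -/
def coverBlock (i : BlockIndex U) : Set Y :=
  Subtype.val '' {y : cell U i.1 | ConnectedComponents.mk y = i.2}

end CoveringPartition

/-! ### Seed systems and local tensorial systems -/

/-- A seed system over `U`: bundles `H j` over the closures of the `U j` (restricted from open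
neighbourhoods), with smooth sections `s j` over these closures (i.e. locally restricted from
smooth sections over open sets) that vanish nowhere on the overlaps. Only the values of `s j` on
`closure (U j)` matter. -/
structure SeedSystem (n : ℕ) {Y : Type u} [TopologicalSpace Y]
    [ChartedSpace (EuclideanQuadrant n) Y] {J : Type} (U : J → Set Y) where
  H : J → SmoothBundle.{u, v} n Y
  closure_subset : ∀ j, closure (U j) ⊆ (H j).base
  s : ∀ j y, (H j).fiber y
  smooth : ∀ j, ∃ V : Opens Y, closure (U j) ⊆ V ∧
    ∃ t, (H j).IsSmoothSection V t ∧ ∀ y ∈ closure (U j), t y = s j y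
  ne_zero : ∀ j, ∀ y ∈ closure (U j) ∩ ⋃ j' ≠ j, closure (U j'), s j y ≠ 0

/-- The local tensorial system generated by a seed system `S`. The bundle blocks are
`F_i = ⨂_{j ∈ J(i)} H_j`. Along a codimension-one face `W` of two blocks `i`, `i'` with
`J(i') = J(i) ∪ {j}`, `j ∉ J(i)`, there is one clutching map, from `i` to `i'`, that inserts `s_j`.
Along other facets `Z`, the clutching maps are the restrictions of those along the faces
`W ⊇ Z`. -/
noncomputable def SeedSystem.localTensorialSystem {n : ℕ} {Y : Type u} [TopologicalSpace Y]
    [ChartedSpace (EuclideanQuadrant n) Y] {J : Type} [DecidableEq J] {U : J → Set Y}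
    (S : SeedSystem.{u, v} n U) : SettlementData.{u, v, u} n (coverBlock U) where
  F i := SmoothBundle.tensor S.H i.1
  edge Z i i' := ∃ W, IsFacet n (coverBlock U) 1 W ∧ Z ⊆ W ∧
    W ⊆ coverBlock U i ∧ W ⊆ coverBlock U i' ∧ ∃ j, j ∉ i.1 ∧ i'.1 = insert j i.1
  clutch {_ i i'} h y := tensorInsert (A := i.1) (B := i'.1)
    (by obtain ⟨_, _, _, _, _, j, _, hj⟩ := h; rw [hj]; exact Finset.subset_insert j i.1)
    (fun j => S.s j y)

/-! The proof reduces to the combinatorics of coordinate half spaces near a point, which is then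
propagated along the strata. Local form. By transversality, the functions defining the `U j` with `p
∈ frontier (U j)` can replace coordinates of a chart at `p` without touching the boundary
coordinates of `Y`. This needs an exchange argument in linear algebra (`exists_coordinate_exchange`)
and an inverse function theorem at a corner (`exists_mem_contDiffGroupoid_of_hasFDerivWithinAt`). In
the new chart these `U j` are half spaces, and every other `U j` contains the whole domain or misses
it. So a cell with prescribed frontier indices `K` and membership indices `L` is convex in the
chart, hence connected, and weakening its inequalities gives points of its closure
(`IsRegularCovering.exists_adapted_chart`). The blocks at `p` therefore correspond to the subsets
`A` of `frontierIndices U p`, with `J(i) = memberIndices U p ∪ A`. They are the quadrants of the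
standard model, and the codimension at `p` is the number of frontier indices. Facets. Position
relative to the `U j` and the blocks is locally constant on a stratum, hence constant on its
components, so inclusions of a facet are tested at one point. Conversely,
`IsRegularCovering.exists_facet_superset` finds around a facet larger facets in every admissible
position. One with a single frontier index `j` realizes the edge from `A` to `A ∪ {j}`; for `k ≥ 2`,
dropping an index other than `j` realizes the same edge along a facet of codimension `k - 1`. Thus
`Q_Z` is a directed cube with sink `K`, and equals `Q'_Z`. Clutching maps. Insertion of tensor
factors is functorial for inclusions of index sets (`tensorInsert_comp`), so a composite depends
only on the ends of the path. It is injective because contraction with a functional that is nonzero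
on `s j` undoes it up to a scalar. Finally, `s j` does not vanish there: as the `U j` cover `Y`,
every `J(i)` is nonempty, so a second closure is always present. -/

/-! ### Exchange of coordinates -/

/-- Linear forms that are independent on a coordinate subspace can replace some of the coordinates
of that subspace. -/
lemma exists_coordinate_exchange {n : ℕ} {ι : Type*} [Finite ι] (B : Set (Fin n))
    (M : Submodule ℝ (EuclideanSpace ℝ (Fin n))) (hM : ∀ v, v ∈ M ↔ ∀ a ∈ B, v a = 0)
    (l : ι → EuclideanSpace ℝ (Fin n) →L[ℝ] ℝ)
    (h : LinearIndependent ℝ fun j => (l j).toLinearMap ∘ₗ M.subtype) :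
    ∃ a : ι → Fin n, Function.Injective a ∧ (∀ j, a j ∉ B) ∧
      ∃ L : EuclideanSpace ℝ (Fin n) ≃L[ℝ] EuclideanSpace ℝ (Fin n),
        (∀ v j, L v (a j) = l j v) ∧ ∀ v, ∀ i ∉ range a, L v i = v i := by
  classical
  cases nonempty_fintype ι
  have hexp : ∀ x : EuclideanSpace ℝ (Fin n), x = ∑ i, x i • EuclideanSpace.single i (1 : ℝ) := by
    intro x
    simpa using ((EuclideanSpace.basisFun (Fin n) ℝ).sum_repr x).symm
  let c : {i // i ∉ B} → (ι → ℝ) := fun i j => l j (EuclideanSpace.single i.1 1)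
  -- Row rank is column rank: a functional killing all columns `c i`, `i ∉ B`, would be a linear
  -- relation between the forms on `M`.
  have hspan : Submodule.span ℝ (range c) = ⊤ := by
    by_contra hne
    obtain ⟨f, hf0, hf⟩ := Submodule.exists_le_ker_of_lt_top _ (lt_top_iff_ne_top.2 hne)
    have hfc : ∀ i, f (c i) = 0 := fun i => hf (Submodule.subset_span ⟨i, rfl⟩)
    have hfe : ∀ w : ι → ℝ, f w = ∑ j, f (Pi.single j 1) * w j := by
      intro w
      conv_lhs => rw [pi_eq_sum_univ' w]
      simp [mul_comm]
    have hzero : ∑ j, f (Pi.single j 1) • ((l j).toLinearMap ∘ₗ M.subtype) = 0 := by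
      ext ⟨x, hx⟩
      have hx' := (hM x).1 hx
      have h1 : (fun j => l j x) = ∑ i, x i • (fun j => l j (EuclideanSpace.single i 1)) := by
        funext j
        conv_lhs => rw [hexp x]
        simp
      have h2 : f (fun j => l j x) = 0 := by
        rw [h1, map_sum]
        refine Finset.sum_eq_zero fun i _ => ?_
        by_cases hi : i ∈ B
        · simp [hx' i hi]
        · rw [map_smul, show f _ = 0 from hfc ⟨i, hi⟩, smul_zero]
      rw [hfe] at h2
      simpa using h2
    have hc := Fintype.linearIndependent_iff.1 h _ hzero
    apply hf0
    ext j
    simpa using hc j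
  -- A basis chosen among the columns. Its indices are the coordinates to be replaced, and they give
  -- an invertible square minor.
  obtain ⟨κ, b, hb, hbs, hbi⟩ := exists_linearIndependent' ℝ c
  let e : κ ≃ ι := (Module.Basis.mk hbi (by rw [hbs, hspan])).indexEquiv (Pi.basisFun ℝ ι)
  let a : ι → Fin n := fun j => (b (e.symm j)).1
  have ha : Function.Injective a := Subtype.val_injective.comp (hb.comp e.symm.injective)
  have hai : LinearIndependent ℝ fun j j' => l j' (EuclideanSpace.single (a j) (1 : ℝ)) :=
    hbi.comp _ e.symm.injective
  refine ⟨a, ha, fun j => (b (e.symm j)).2, ?_⟩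
  let L₀ : EuclideanSpace ℝ (Fin n) →ₗ[ℝ] EuclideanSpace ℝ (Fin n) :=
    { toFun := fun v => WithLp.toLp 2 fun i => if hi : ∃ j, a j = i then l hi.choose v else v i
      map_add' := by
        intro x y
        ext i
        by_cases hi : ∃ j, a j = i <;> simp [hi]
      map_smul' := by
        intro r x
        ext i
        by_cases hi : ∃ j, a j = i <;> simp [hi] }
  have h1 : ∀ v j, L₀ v (a j) = l j v := by
    intro v j
    have hi : ∃ j', a j' = a j := ⟨j, rfl⟩
    have : hi.choose = j := ha hi.choose_spec
    simp only [L₀, LinearMap.coe_mk, AddHom.coe_mk, dif_pos hi]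
    rw [this]
  have h2 : ∀ v, ∀ i ∉ range a, L₀ v i = v i := by
    intro v i hi
    simp only [L₀, LinearMap.coe_mk, AddHom.coe_mk]
    exact dif_neg hi
  -- On the kernel all kept coordinates vanish, so the forms see only the coordinates in `range a`,
  -- where the minor is invertible.
  have hinj : Function.Injective L₀ := by
    rw [injective_iff_map_eq_zero]
    intro x hx
    have hx0 : ∀ i ∉ range a, x i = 0 := fun i hi => by rw [← h2 x i hi, hx]; rfl
    have hx1 : ∀ j, l j x = 0 := fun j => by rw [← h1 x j, hx]; rfl
    have hx2 : ∑ j, x (a j) • (fun j' => l j' (EuclideanSpace.single (a j) (1 : ℝ))) = 0 := by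
      funext j'
      have h3 := hx1 j'
      rw [hexp x, map_sum] at h3
      rw [← Finset.sum_subset (Finset.subset_univ (Finset.univ.image a)),
        Finset.sum_image fun _ _ _ _ h => ha h] at h3
      · simpa using h3
      · intro i _ hi
        rw [hx0 i (by simpa using hi)]
        simp
    have hx3 := Fintype.linearIndependent_iff.1 hai _ hx2
    ext i
    by_cases hi : i ∈ range a
    · obtain ⟨j, rfl⟩ := hi
      exact hx3 j
    · exact hx0 i hi
  exact ⟨(LinearEquiv.ofInjectiveEndo L₀ hinj).toContinuousLinearEquiv, h1, h2⟩

/-! ### Inverse functions on quadrants -/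

/-- A homeomorphism between open sets that preserves a set `Q`, and is smooth within `Q` with
invertible derivatives, has an inverse that is smooth within `Q`. -/
lemma OpenPartialHomeomorph.contDiffOn_symm_inter {E : Type*} [NormedAddCommGroup E]
    [NormedSpace ℝ E] [CompleteSpace E] (P : OpenPartialHomeomorph E E) {Q : Set E}
    (hs : UniqueDiffOn ℝ (P.source ∩ Q)) (ht : UniqueDiffOn ℝ (P.target ∩ Q))
    (hPQ : ∀ x ∈ P.source, P x ∈ Q ↔ x ∈ Q) (hP : ContDiffOn ℝ ∞ P (P.source ∩ Q))
    (hinv : ∀ x ∈ P.source ∩ Q, (fderivWithin ℝ P (P.source ∩ Q) x).IsInvertible) :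
    ContDiffOn ℝ ∞ P.symm (P.target ∩ Q) := by
  have hmaps : MapsTo P.symm (P.target ∩ Q) (P.source ∩ Q) := by
    rintro y ⟨hy, hyQ⟩
    have := P.map_target hy
    exact ⟨this, (hPQ _ this).1 (by rwa [P.right_inv hy])⟩
  have hD : ContDiffOn ℝ ∞ (fderivWithin ℝ P (P.source ∩ Q)) (P.source ∩ Q) :=
    hP.fderivWithin hs le_rfl
  rw [contDiffOn_infty]
  intro m
  induction m with
  | zero =>
    simpa using P.continuousOn_symm.mono inter_subset_left
  | succ m ih =>
    push_cast
    -- Bootstrap: the derivative of the inverse at `y` is the inverse of the derivative of `P` at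
    -- `P.symm y`, which is `C^m` in `y` once `P.symm` is.
    rw [contDiffOn_succ_iff_hasFDerivWithinAt_of_uniqueDiffOn ht]
    refine ⟨fun h => by simp at h,
      fun y => (fderivWithin ℝ P (P.source ∩ Q) (P.symm y)).inverse, ?_, ?_⟩
    · have h1 := (contDiffOn_infty.1 hD m).comp ih hmaps
      intro y hy
      exact ((hinv _ (hmaps hy)).contDiffAt_map_inverse).comp_contDiffWithinAt y (h1 y hy)
    · intro y hy
      obtain ⟨M, hM⟩ := hinv _ (hmaps hy)
      simp only [← hM, ContinuousLinearMap.inverse_equiv]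
      refine HasFDerivWithinAt.of_local_left_inverse (f := P) (t := P.source ∩ Q) ?_ ?_ hy ?_
      · exact ((P.continuousOn_symm.mono inter_subset_left) y hy).tendsto_nhdsWithin hmaps
      · rw [hM]
        exact (hP.differentiableOn (by simp) _ (hmaps hy)).hasFDerivWithinAt
      · filter_upwards [self_mem_nhdsWithin] with z hz using P.right_inv hz.1

/-- A homeomorphism between open sets of the model vector space that preserves the range of the
model with corners induces a homeomorphism between open sets of the model space. -/
noncomputable def OpenPartialHomeomorph.restrictModel {E H : Type*} [NormedAddCommGroup E] [NormedSpace ℝ E]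
    [TopologicalSpace H] (I : ModelWithCorners ℝ E H) (P : OpenPartialHomeomorph E E)
    (h : ∀ x ∈ P.source, P x ∈ range I ↔ x ∈ range I) : OpenPartialHomeomorph H H where
  toFun z := I.symm (P (I z))
  invFun z := I.symm (P.symm (I z))
  source := I ⁻¹' P.source
  target := I ⁻¹' P.target
  map_source' z hz := by
    have := (h _ hz).2 ⟨z, rfl⟩
    simpa [I.right_inv this] using P.map_source hz
  map_target' z hz := by
    have h1 := P.map_target hz
    have := (h _ h1).1 (by rw [P.right_inv hz]; exact ⟨z, rfl⟩)
    simpa [I.right_inv this] using h1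
  left_inv' z hz := by
    have := (h _ hz).2 ⟨z, rfl⟩
    rw [I.right_inv this, P.left_inv hz, I.left_inv]
  right_inv' z hz := by
    have h1 := P.map_target hz
    have := (h _ h1).1 (by rw [P.right_inv hz]; exact ⟨z, rfl⟩)
    rw [I.right_inv this, P.right_inv hz, I.left_inv]
  open_source := P.open_source.preimage I.continuous
  open_target := P.open_target.preimage I.continuous
  continuousOn_toFun := I.continuous_symm.comp_continuousOn
    (P.continuousOn.comp I.continuous.continuousOn fun _ h => h)
  continuousOn_invFun := I.continuous_symm.comp_continuousOn
    (P.continuousOn_symm.comp I.continuous.continuousOn fun _ h => h)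

/-- Only the behaviour within `range I` counts, so this applies to a `P` obtained by a non-smooth
extension across the boundary. -/
lemma OpenPartialHomeomorph.restrictModel_mem_contDiffGroupoid {E H : Type*}
    [NormedAddCommGroup E] [NormedSpace ℝ E] [TopologicalSpace H] (I : ModelWithCorners ℝ E H)
    (P : OpenPartialHomeomorph E E) (h : ∀ x ∈ P.source, P x ∈ range I ↔ x ∈ range I)
    (h1 : ContDiffOn ℝ ∞ P (P.source ∩ range I))
    (h2 : ContDiffOn ℝ ∞ P.symm (P.target ∩ range I)) :
    P.restrictModel I h ∈ contDiffGroupoid ∞ I := by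
  rw [contDiffGroupoid, mem_groupoid_of_pregroupoid]
  constructor
  · refine h1.congr_mono ?_ ?_
    · rintro x ⟨hx, hxQ⟩
      have hx' : x ∈ P.source := by simpa [restrictModel, I.right_inv hxQ] using hx
      have := (h _ hx').2 hxQ
      simp [restrictModel, I.right_inv hxQ, I.right_inv this]
    · rintro x ⟨hx, hxQ⟩
      exact ⟨by simpa [restrictModel, I.right_inv hxQ] using hx, hxQ⟩
  · refine h2.congr_mono ?_ ?_
    · rintro x ⟨hx, hxQ⟩
      have hx' : x ∈ P.target := by simpa [restrictModel, I.right_inv hxQ] using hx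
      have := (h _ (P.map_target hx')).1 (by rwa [P.right_inv hx'])
      simp [restrictModel, I.right_inv hxQ, I.right_inv this]
    · rintro x ⟨hx, hxQ⟩
      exact ⟨by simpa [restrictModel, I.right_inv hxQ] using hx, hxQ⟩

lemma mem_range_cornerModel {n : ℕ} {x : EuclideanSpace ℝ (Fin n)} :
    x ∈ range (cornerModel n) ↔ ∀ i, 0 ≤ x i := by
  change x ∈ range (Subtype.val : EuclideanQuadrant n → _) ↔ _
  rw [range_euclideanQuadrant]
  rfl

lemma cornerModel_symm_apply {n : ℕ} (x : EuclideanSpace ℝ (Fin n)) (i : Fin n) :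
    cornerModel n ((cornerModel n).symm x) i = max (x i) 0 := rfl

/-- Clamping each coordinate at `0` is a contraction. Precomposition with it carries Lipschitz
bounds from the quadrant to the whole space with the same constant. -/
lemma norm_cornerModel_symm_sub_le {n : ℕ} (x y : EuclideanSpace ℝ (Fin n)) :
    ‖cornerModel n ((cornerModel n).symm x) - cornerModel n ((cornerModel n).symm y)‖ ≤
      ‖x - y‖ := by
  rw [EuclideanSpace.norm_eq, EuclideanSpace.norm_eq]
  refine Real.sqrt_le_sqrt (Finset.sum_le_sum fun i _ => ?_)
  rw [PiLp.sub_apply, PiLp.sub_apply, cornerModel_symm_apply, cornerModel_symm_apply]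
  gcongr
  exact abs_max_sub_max_le_abs (x i) (y i) 0

/-- The inverse function theorem at a point of the quadrant `[0,∞)ⁿ`, for maps that preserve the
boundary coordinates at this point. -/
theorem exists_mem_contDiffGroupoid_of_hasFDerivWithinAt {n : ℕ} (x₀ : EuclideanQuadrant n)
    (ψ : EuclideanSpace ℝ (Fin n) → EuclideanSpace ℝ (Fin n)) {W : Set (EuclideanSpace ℝ (Fin n))}
    (hW : IsOpen W) (hx₀ : x₀.1 ∈ W) (hψ : ContDiffOn ℝ ∞ ψ (W ∩ range (cornerModel n)))
    (L : EuclideanSpace ℝ (Fin n) ≃L[ℝ] EuclideanSpace ℝ (Fin n))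
    (hL : HasFDerivWithinAt ψ (L : EuclideanSpace ℝ (Fin n) →L[ℝ] EuclideanSpace ℝ (Fin n))
      (range (cornerModel n)) x₀.1)
    (hLbd : ∀ v i, x₀.1 i = 0 → L v i = v i)
    (hbd : ∀ x ∈ W ∩ range (cornerModel n), ∀ i, x₀.1 i = 0 → ψ x i = x i)
    (hpos : ∀ i, x₀.1 i ≠ 0 → 0 < ψ x₀.1 i) :
    ∃ e ∈ contDiffGroupoid ∞ (cornerModel n), x₀ ∈ e.source ∧
      ∀ x ∈ e.source, x.1 ∈ W ∧ (e x).1 = ψ x.1 := by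
  set I := cornerModel n with hI
  have hx₀Q : x₀.1 ∈ range I := ⟨x₀, rfl⟩
  have hQ : UniqueDiffOn ℝ (range I) := I.uniqueDiffOn
  have hWQ : UniqueDiffOn ℝ (W ∩ range I) := by
    rw [inter_comm]; exact hQ.inter hW
  set D := fderivWithin ℝ ψ (W ∩ range I) with hD
  have hDc : ContinuousOn D (W ∩ range I) := hψ.continuousOn_fderivWithin hWQ (by simp)
  have hD₀ : D x₀.1 = L :=
    (hL.mono inter_subset_right).fderivWithin (hWQ _ ⟨hx₀, hx₀Q⟩)
  -- The deviation from `L` must stay below `‖L⁻¹‖⁻¹` for the inverse function theorem; in the zero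
  -- space any positive constant serves.
  obtain ⟨c, hc0, hc⟩ : ∃ c : NNReal, 0 < c ∧
      (Subsingleton (EuclideanSpace ℝ (Fin n)) ∨
        c < ‖(L.symm : EuclideanSpace ℝ (Fin n) →L[ℝ] EuclideanSpace ℝ (Fin n))‖₊⁻¹) := by
    rcases L.subsingleton_or_nnnorm_symm_pos with h | h
    · exact ⟨1, one_pos, .inl h⟩
    · obtain ⟨c, h1, h2⟩ := exists_between (inv_pos.2 h)
      exact ⟨c, h1, .inr h2⟩
  have hgood : ∀ᶠ x in 𝓝[W ∩ range I] x₀.1, ‖D x - L‖ ≤ c ∧ (D x).IsInvertible := by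
    have hDt : Filter.Tendsto D (𝓝[W ∩ range I] x₀.1) (𝓝 L) := by
      have := hDc _ ⟨hx₀, hx₀Q⟩
      rwa [ContinuousWithinAt, hD₀] at this
    filter_upwards [hDt (Metric.closedBall_mem_nhds _ (NNReal.coe_pos.2 hc0)),
      hDt (ContinuousLinearEquiv.nhds L)] with x hx1 hx2
    exact ⟨by simpa [dist_eq_norm] using hx1, hx2⟩
  obtain ⟨ρ, hρ, hball⟩ : ∃ ρ > 0, Metric.ball x₀.1 ρ ∩ range I ⊆
      {x | x ∈ W ∧ ‖D x - L‖ ≤ c ∧ (D x).IsInvertible} := by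
    have h1 : {x | x ∈ W ∧ ‖D x - L‖ ≤ c ∧ (D x).IsInvertible} ∈ 𝓝[range I] x₀.1 := by
      rw [inter_comm, nhdsWithin_inter_of_mem' (mem_nhdsWithin_of_mem_nhds (hW.mem_nhds hx₀))]
        at hgood
      filter_upwards [hgood, mem_nhdsWithin_of_mem_nhds (hW.mem_nhds hx₀)] with x h1 h2
        using ⟨h2, h1⟩
    exact Metric.mem_nhdsWithin_iff.1 h1
  set r : EuclideanSpace ℝ (Fin n) → EuclideanSpace ℝ (Fin n) := fun x => I (I.symm x) with hr
  have hrQ : ∀ x, r x ∈ range I := fun x => ⟨_, rfl⟩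
  have hrid : ∀ x ∈ range I, r x = x := fun x hx => I.right_inv hx
  have hrball : ∀ x ∈ Metric.ball x₀.1 ρ, r x ∈ Metric.ball x₀.1 ρ := by
    intro x hx
    rw [Metric.mem_ball, dist_eq_norm] at hx ⊢
    refine lt_of_le_of_lt ?_ hx
    have := norm_cornerModel_symm_sub_le x x₀.1
    rwa [show (cornerModel n) ((cornerModel n).symm x₀.1) = x₀.1 from hrid _ hx₀Q] at this
  -- Extension of `ψ` off the quadrant: only the error `ψ - L` is precomposed with the clamp `r`.
  -- Its Lipschitz constant stays at most `c`, so `ψ'` approximates `L` on a full ball, though it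
  -- need not be differentiable across the boundary.
  set ψ' : EuclideanSpace ℝ (Fin n) → EuclideanSpace ℝ (Fin n) :=
    fun x => L x + (ψ (r x) - L (r x)) with hψ'
  have hψ'Q : ∀ x ∈ range I, ψ' x = ψ x := by
    intro x hx
    simp [hψ', hrid x hx]
  have hconv : Convex ℝ (Metric.ball x₀.1 ρ ∩ range I) := (convex_ball _ _).inter I.convex_range
  have happ : ApproximatesLinearOn ψ'
      (L : EuclideanSpace ℝ (Fin n) →L[ℝ] EuclideanSpace ℝ (Fin n)) (Metric.ball x₀.1 ρ) c := by
    intro x hx y hy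
    have h1 : ∀ z ∈ Metric.ball x₀.1 ρ ∩ range I,
        HasFDerivWithinAt ψ (D z) (Metric.ball x₀.1 ρ ∩ range I) z := by
      intro z hz
      have : z ∈ W ∩ range I := ⟨(hball hz).1, hz.2⟩
      exact ((hψ.differentiableOn (by simp) z this).hasFDerivWithinAt).mono
        fun w hw => ⟨(hball hw).1, hw.2⟩
    have h2 := hconv.norm_image_sub_le_of_norm_hasFDerivWithin_le' h1
      (fun z hz => (hball hz).2.1) ⟨hrball y hy, hrQ y⟩ ⟨hrball x hx, hrQ x⟩
    have h3 : ψ' x - ψ' y - L (x - y) = ψ (r x) - ψ (r y) - L (r x - r y) := by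
      simp only [hψ', map_sub]; abel
    calc ‖ψ' x - ψ' y - L (x - y)‖ = ‖ψ (r x) - ψ (r y) - L (r x - r y)‖ := by rw [h3]
      _ ≤ c * ‖r x - r y‖ := h2
      _ ≤ c * ‖x - y‖ := by
        gcongr
        exact norm_cornerModel_symm_sub_le x y
  -- Coordinates nonzero at `x₀` are kept positive before and after `ψ'`. Membership in the quadrant
  -- is then decided by the coordinates vanishing at `x₀`, which `ψ'` preserves.
  set S : Set (EuclideanSpace ℝ (Fin n)) := Metric.ball x₀.1 ρ ∩
    (fun x => (x, ψ' x)) ⁻¹' {z | ∀ i, x₀.1 i ≠ 0 → 0 < z.1 i ∧ 0 < z.2 i} with hS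
  have hSo : IsOpen S := by
    refine (continuousOn_id.prodMk happ.continuousOn).isOpen_inter_preimage Metric.isOpen_ball ?_
    have hpr : ∀ i, Continuous fun x : EuclideanSpace ℝ (Fin n) => x i := fun i => by fun_prop
    simp only [ofPred_forall]
    refine isOpen_iInter_of_finite fun i => isOpen_iInter_of_finite fun _ => ?_
    exact (isOpen_lt continuous_const
      ((hpr i).comp continuous_fst)).inter
      (isOpen_lt continuous_const
        ((hpr i).comp continuous_snd))
  have hx₀S : x₀.1 ∈ S := by
    refine ⟨Metric.mem_ball_self hρ, fun i hi => ⟨lt_of_le_of_ne (x₀.2 i) (Ne.symm hi), ?_⟩⟩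
    simpa [hψ'Q _ hx₀Q] using hpos i hi
  set P := (happ.mono_set (inter_subset_left : S ⊆ _)).toOpenPartialHomeomorph ψ' S hc hSo with hP
  have hSQ : ∀ x ∈ S, ψ' x ∈ range I ↔ x ∈ range I := by
    rintro x ⟨hxb, hx⟩
    have hco : ∀ i, x₀.1 i = 0 → ψ' x i = x i := by
      intro i hi
      have := hbd (r x) ⟨(hball ⟨hrball x hxb, hrQ x⟩).1, hrQ x⟩ i hi
      simp only [hψ', PiLp.add_apply, PiLp.sub_apply, hLbd _ i hi, this]
      ring
    rw [hI, mem_range_cornerModel, mem_range_cornerModel]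
    refine forall_congr' fun i => ?_
    by_cases hi : x₀.1 i = 0
    · rw [hco i hi]
    · exact iff_of_true (hx i hi).2.le (hx i hi).1.le
  have hsub : P.source ∩ range I ⊆ W ∩ range I := fun x hx =>
    ⟨(hball ⟨hx.1.1, hx.2⟩).1, hx.2⟩
  have hu1 : UniqueDiffOn ℝ (P.source ∩ range I) := by
    rw [inter_comm]; exact hQ.inter P.open_source
  have hu2 : UniqueDiffOn ℝ (P.target ∩ range I) := by
    rw [inter_comm]; exact hQ.inter P.open_target
  have hPd : ContDiffOn ℝ ∞ P (P.source ∩ range I) :=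
    (hψ.mono hsub).congr fun x hx => hψ'Q x hx.2
  refine ⟨P.restrictModel I hSQ, P.restrictModel_mem_contDiffGroupoid I hSQ hPd
    (P.contDiffOn_symm_inter hu1 hu2 hSQ hPd ?_), hx₀S, ?_⟩
  · intro x hx
    have h1 : HasFDerivWithinAt P (D x) (P.source ∩ range I) x :=
      (((hψ.differentiableOn (by simp) x (hsub hx)).hasFDerivWithinAt).mono hsub).congr
        (fun y hy => hψ'Q y hy.2) (hψ'Q x hx.2)
    rw [h1.fderivWithin (hu1 x hx)]
    exact (hball ⟨hx.1.1, hx.2⟩).2.2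
  · intro x hx
    have hxQ : x.1 ∈ range I := ⟨x, rfl⟩
    refine ⟨(hball ⟨hx.1, hxQ⟩).1, ?_⟩
    exact (I.right_inv ((hSQ _ hx).2 hxQ)).trans (hψ'Q _ hxQ)

/-! ### Charts adapted to a regular covering -/

lemma trans_mem_maximalAtlas {H M : Type*} [TopologicalSpace H] [TopologicalSpace M]
    [ChartedSpace H M] {G : StructureGroupoid H} {c : OpenPartialHomeomorph M H}
    (hc : c ∈ G.maximalAtlas M) {e : OpenPartialHomeomorph H H} (he : e ∈ G) :
    c ≫ₕ e ∈ G.maximalAtlas M := by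
  rw [mem_maximalAtlas_iff] at hc ⊢
  intro e' he'
  constructor
  · rw [OpenPartialHomeomorph.trans_symm_eq_symm_trans_symm, OpenPartialHomeomorph.trans_assoc]
    exact G.trans (G.symm he) (hc e' he').1
  · rw [← OpenPartialHomeomorph.trans_assoc]
    exact G.trans (hc e' he').2 he

section

variable {n : ℕ} {Y : Type u} [TopologicalSpace Y] [ChartedSpace (EuclideanQuadrant n) Y]

/-- A chart in the maximal atlas can be restricted to an open neighbourhood of a point such that its
image becomes the part of the quadrant in a ball. -/
lemma exists_chart_target_eq_ball [IsManifold (cornerModel n) ∞ Y]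
    {φ : OpenPartialHomeomorph Y (EuclideanQuadrant n)}
    (hφ : φ ∈ IsManifold.maximalAtlas (cornerModel n) ∞ Y) {p : Y} (hp : p ∈ φ.source) {N : Set Y}
    (hN : N ∈ 𝓝 p) :
    ∃ φ' ∈ IsManifold.maximalAtlas (cornerModel n) ∞ Y, p ∈ φ'.source ∧
      φ'.source ⊆ φ.source ∩ N ∧ (∀ y, φ' y = φ y) ∧
      ∃ ρ > 0, φ'.target = {x | x.1 ∈ Metric.ball (φ p).1 ρ} := by
  have h1 : φ.target ∩ φ.symm ⁻¹' N ∈ 𝓝 (φ p) :=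
    Filter.inter_mem (φ.open_target.mem_nhds (φ.map_source hp))
      (φ.symm.continuousAt (φ.map_source hp) (by rwa [φ.left_inv hp]))
  rw [mem_nhds_induced] at h1
  obtain ⟨O, hO, hOsub⟩ := h1
  obtain ⟨ρ, hρ, hball⟩ := Metric.mem_nhds_iff.1 hO
  set s : Set Y := φ.source ∩ φ ⁻¹' {x | x.1 ∈ Metric.ball (φ p).1 ρ} with hs
  have hso : IsOpen s := φ.continuousOn.isOpen_inter_preimage φ.open_source
    (Metric.isOpen_ball.preimage continuous_subtype_val)
  refine ⟨φ.restr s, restr_mem_maximalAtlas _ hφ hso, ?_, ?_, fun _ => rfl, ρ, hρ, ?_⟩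
  · rw [φ.restr_source' s hso]
    exact ⟨hp, hp, Metric.mem_ball_self hρ⟩
  · rw [φ.restr_source' s hso]
    rintro y ⟨hy, -, hy'⟩
    have := hOsub (hball hy' : φ y ∈ _)
    refine ⟨hy, ?_⟩
    simpa [φ.left_inv hy] using this.2
  · rw [OpenPartialHomeomorph.restr_target, hso.interior_eq]
    ext x
    constructor
    · rintro ⟨hx, -, hx'⟩
      rwa [mem_preimage, φ.right_inv hx] at hx'
    · intro hx
      have := hOsub (hball hx : x ∈ _)
      exact ⟨this.1, φ.map_target this.1, by rwa [mem_preimage, φ.right_inv this.1]⟩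

/-- Near each point `p` there is a chart in which the members of a regular covering with `p` in
their boundary are given by inequalities for different coordinates, and all other members either
contain the domain of the chart or do not meet it. -/
theorem IsRegularCovering.exists_chart [IsManifold (cornerModel n) ∞ Y] {J : Type} [Finite J]
    {U : J → Set Y} (hU : IsRegularCovering n U) (p : Y) :
    ∃ φ ∈ IsManifold.maximalAtlas (cornerModel n) ∞ Y, p ∈ φ.source ∧
      ∃ a : {j // p ∈ frontier (U j)} → Fin n, Function.Injective a ∧
        (∀ j, 0 < (φ p).1 (a j)) ∧
        (∀ (j : {j // p ∈ frontier (U j)}), ∀ y ∈ φ.source,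
          y ∈ U j ↔ (φ p).1 (a j) < (φ y).1 (a j)) ∧
        (∀ j, p ∉ frontier (U j) → ∀ y ∈ φ.source, y ∈ U j ↔ p ∈ U j) ∧
        ∃ ρ > 0, φ.target = {x | x.1 ∈ Metric.ball (φ p).1 ρ} := by
  classical
  obtain ⟨V, f, hpV, hfV, hfU, hind⟩ := hU.transverse p
  set I := cornerModel n with hI
  have hV : (V : Set Y) ∈ 𝓝 p := V.isOpen.mem_nhds hpV
  -- `p` is outside the open set `U j` but in its closure, which excludes both signs.
  have hf0 : ∀ j, f j p = 0 := by
    intro j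
    have hpj : p ∉ U j := by
      have := j.2
      rw [(hU.isOpen j).frontier_eq] at this
      exact this.2
    refine le_antisymm (not_lt.1 fun h => hpj ((hfU j p hpV).2 h)) (not_lt.1 fun h => ?_)
    have h1 : ∀ᶠ y in 𝓝 p, f j y < 0 :=
      ((hfV j).continuousOn.continuousAt hV).eventually_lt continuousAt_const h
    obtain ⟨y, ⟨hy1, hyV⟩, hyU⟩ := mem_closure_iff_nhds.1 (frontier_subset_closure j.2) _
      (Filter.inter_mem h1 hV)
    exact absurd ((hfU j y hyV).1 hyU) (not_lt.2 (le_of_lt hy1))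
  set c := chartAt (EuclideanQuadrant n) p with hc
  have hpc : p ∈ c.source := mem_chart_source _ p
  let l : {j // p ∈ frontier (U j)} → EuclideanSpace ℝ (Fin n) →L[ℝ] ℝ :=
    fun j => mfderiv I 𝓘(ℝ, ℝ) (f j) p
  obtain ⟨a, ha, haB, L, hLa, hL⟩ := exists_coordinate_exchange
    {i | extChartAt I p p i = 0} (stratumTangent n p) (fun v => Iff.rfl) l hind
  let F : {j // p ∈ frontier (U j)} → EuclideanSpace ℝ (Fin n) → ℝ :=
    fun j x => f j (c.symm (I.symm x))
  let W : Set (EuclideanSpace ℝ (Fin n)) := I.symm ⁻¹' (c.target ∩ c.symm ⁻¹' V)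
  have hW : IsOpen W :=
    (c.continuousOn_symm.isOpen_inter_preimage c.open_target V.isOpen).preimage I.continuous_symm
  have hIc : ∀ y, I.symm (c y).1 = c y := fun y => I.left_inv (c y)
  have hx₀W : (c p).1 ∈ W := by
    change I.symm (c p).1 ∈ c.target ∩ c.symm ⁻¹' V
    rw [hIc]
    exact ⟨c.map_source hpc, by simpa [c.left_inv hpc] using hpV⟩
  have hFs : ∀ j, ContDiffOn ℝ ∞ (F j) (W ∩ range I) := by
    intro j
    rw [← contMDiffOn_iff_contDiffOn]
    refine (hfV j).comp ((contMDiffOn_extChartAt_symm (I := I) p).mono ?_) ?_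
    · rintro x ⟨hx, hxQ⟩
      rw [extChartAt_target]
      exact ⟨hx.1, hxQ⟩
    · rintro x ⟨hx, hxQ⟩
      exact hx.2
  have hFd : ∀ j, HasFDerivWithinAt (F j) (l j) (range I) (c p).1 := by
    intro j
    have h1 : MDifferentiableAt I 𝓘(ℝ, ℝ) (f j) p :=
      ((hfV j).contMDiffAt hV).mdifferentiableAt (by simp)
    exact h1.hasMFDerivAt.2
  -- The shift by `1` makes the new coordinates positive at `p`, so that the walls `f j = 0` stay
  -- away from the boundary of the quadrant.
  let ψ : EuclideanSpace ℝ (Fin n) → EuclideanSpace ℝ (Fin n) := fun x =>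
    WithLp.toLp 2 (Function.extend a (fun j => F j x + 1) (fun i => x i))
  have hψa : ∀ x j, ψ x (a j) = F j x + 1 := fun x j =>
    ha.extend_apply (fun j => F j x + 1) (fun i => x i) j
  have hψn : ∀ x, ∀ i ∉ range a, ψ x i = x i := fun x i hi =>
    
    Function.extend_apply' (fun j => F j x + 1) (fun i => x i) i hi
  have hnr : ∀ i, (c p).1 i = 0 → i ∉ range a := by
    rintro _ hi ⟨j, rfl⟩
    exact haB j hi
  have hFp : ∀ j, F j (c p).1 = 0 := by
    intro j
    change f j (c.symm (I.symm (c p).1)) = 0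
    rw [hIc, c.left_inv hpc, hf0]
  obtain ⟨e, he, hpe, heψ⟩ := exists_mem_contDiffGroupoid_of_hasFDerivWithinAt (c p) ψ hW hx₀W
    (by
      rw [contDiffOn_euclidean]
      intro i
      by_cases hi : i ∈ range a
      · obtain ⟨j, rfl⟩ := hi
        simp only [hψa]
        exact (hFs j).add contDiffOn_const
      · simp only [hψn _ i hi]
        exact (EuclideanSpace.proj (𝕜 := ℝ) i).contDiff.contDiffOn) L
    (by
      rw [hasFDerivWithinAt_euclidean]
      intro i
      by_cases hi : i ∈ range a
      · obtain ⟨j, rfl⟩ := hi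
        simp only [hψa]
        convert! (hFd j).add_const 1 using 1
        ext v
        exact hLa v j
      · simp only [hψn _ i hi]
        convert! (EuclideanSpace.proj (𝕜 := ℝ) i : EuclideanSpace ℝ (Fin n) →L[ℝ] ℝ).hasFDerivWithinAt
          using 1
        ext v
        exact hL v i hi)
    (fun v i hi => hL v i (hnr i hi)) (fun x _ i hi => hψn x i (hnr i hi))
    (by
      intro i hi
      by_cases hi' : i ∈ range a
      · obtain ⟨j, rfl⟩ := hi'
        rw [hψa, hFp]
        norm_num
      · rw [hψn _ i hi']
        exact lt_of_le_of_ne ((c p).2 i) (Ne.symm hi))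
  -- A point off the frontier is interior to `U j` or to its complement; finitely many such
  -- conditions hold on a common neighbourhood.
  have hN : {y | ∀ j, p ∉ frontier (U j) → (y ∈ U j ↔ p ∈ U j)} ∈ 𝓝 p := by
    change ∀ᶠ y in 𝓝 p, ∀ j, p ∉ frontier (U j) → (y ∈ U j ↔ p ∈ U j)
    rw [Filter.eventually_all]
    intro j
    by_cases hj : p ∈ frontier (U j)
    · exact Filter.Eventually.of_forall fun _ h => absurd hj h
    · by_cases hpj : p ∈ U j
      · filter_upwards [(hU.isOpen j).mem_nhds hpj] with y hy _
        exact iff_of_true hy hpj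
      · have : p ∉ closure (U j) := fun h => hj (by
          rw [(hU.isOpen j).frontier_eq]; exact ⟨h, hpj⟩)
        filter_upwards [isClosed_closure.isOpen_compl.mem_nhds this] with y hy _
        exact iff_of_false (fun h => hy (subset_closure h)) hpj
  obtain ⟨φ, hφ, hpφ, hφs, hφe, ρ, hρ, hφt⟩ := exists_chart_target_eq_ball
    (trans_mem_maximalAtlas (IsManifold.chart_mem_maximalAtlas p) he)
    (show p ∈ (c ≫ₕ e).source by
      rw [OpenPartialHomeomorph.trans_source]; exact ⟨hpc, hpe⟩) hN
  have hφa : ∀ y ∈ φ.source, y ∈ V ∧ ∀ j, (φ y).1 (a j) = f j y + 1 := by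
    intro y hy
    have h1 := (hφs hy).1
    rw [OpenPartialHomeomorph.trans_source] at h1
    obtain ⟨h2, h3⟩ := heψ _ h1.2
    have h4 : c.symm (I.symm (c y).1) = y := by rw [hIc, c.left_inv h1.1]
    refine ⟨?_, fun j => ?_⟩
    · have := h2.2
      rwa [mem_preimage, h4] at this
    · rw [hφe]
      change (e (c y)).1 (a j) = _
      rw [h3, hψa]
      change f j (c.symm (I.symm (c y).1)) + 1 = _
      rw [h4]
  refine ⟨φ, hφ, hpφ, a, ha, fun j => ?_, fun j y hy => ?_, fun j hj y hy => (hφs hy).2 j hj, ρ, hρ,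
    ?_⟩
  · rw [(hφa p hpφ).2, hf0]
    norm_num
  · rw [(hφa p hpφ).2, (hφa y hy).2, hf0, hfU j y (hφa y hy).1]
    simp
  · rw [hφe p]
    exact hφt

end

/-! ### Local structure of a regular covering -/

section

variable {Y : Type u} [TopologicalSpace Y] {J : Type}

/-- The points that lie in the boundary of `U j` exactly for `j ∈ K` and in `U j` exactly for
`j ∈ L`. -/
def openCell (U : J → Set Y) (K L : Finset J) : Set Y :=
  {y | (∀ j, y ∈ frontier (U j) ↔ j ∈ K) ∧ ∀ j, y ∈ U j ↔ j ∈ L}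

/-- The set defined by the weak form of the inequalities that define `openCell U K L`. -/
def weakCell (U : J → Set Y) (K L : Finset J) : Set Y :=
  {y | (∀ j ∈ K, y ∈ frontier (U j)) ∧ (∀ j ∈ L, y ∈ closure (U j)) ∧ ∀ j ∉ L, y ∉ U j}

/-- `L` consists of all indices `j` with `p ∈ U j` and of some of those with `p` in the boundary of
`U j`. -/
def IsAdjacent (U : J → Set Y) (p : Y) (L : Finset J) : Prop :=
  ∀ j, p ∉ frontier (U j) → (j ∈ L ↔ p ∈ U j)

lemma notMem_of_mem_frontier {V : Set Y} (hV : IsOpen V) {p : Y} (hp : p ∈ frontier V) :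
    p ∉ V := by
  rw [hV.frontier_eq] at hp
  exact hp.2

lemma IsAdjacent.mem_weakCell {U : J → Set Y} (hU : ∀ j, IsOpen (U j)) {p : Y} {K L : Finset J}
    (hL : IsAdjacent U p L) (hK : ∀ j ∈ K, p ∈ frontier (U j)) : p ∈ weakCell U K L := by
  refine ⟨hK, fun j hj => ?_, fun j hj => ?_⟩
  · by_cases h : p ∈ frontier (U j)
    · exact frontier_subset_closure h
    · exact subset_closure ((hL j h).1 hj)
  · by_cases h : p ∈ frontier (U j)
    · exact notMem_of_mem_frontier (hU j) h
    · exact fun h' => hj ((hL j h).2 h')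

/-- A neighbourhood of `p` in which the covering `U` looks like a covering by coordinate half
spaces. -/
structure IsAdaptedNhd (U : J → Set Y) (p : Y) (O : Set Y) : Prop where
  isOpen : IsOpen O
  mem : p ∈ O
  mem_iff : ∀ j, p ∉ frontier (U j) → ∀ y ∈ O, y ∈ U j ↔ p ∈ U j
  connected : ∀ K L : Finset J, (∀ j ∈ K, p ∈ frontier (U j)) → Disjoint K L → IsAdjacent U p L →
    IsConnected (openCell U K L ∩ O)
  closure : ∀ K L : Finset J, (∀ j ∈ K, p ∈ frontier (U j)) → Disjoint K L → IsAdjacent U p L →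
    weakCell U K L ∩ O ⊆ closure (openCell U K L ∩ O)

/-- Otherwise membership in `U j` would be constant on `O`, which fails near a frontier point. So
frontier indices can only disappear on moving away from `p`. -/
lemma IsAdaptedNhd.mem_frontier {U : J → Set Y} {p : Y} {O : Set Y} (h : IsAdaptedNhd U p O)
    {y : Y} (hy : y ∈ O) {j : J} (hj : y ∈ frontier (U j)) : p ∈ frontier (U j) := by
  by_contra hp
  have hO := h.isOpen.mem_nhds hy
  rw [frontier_eq_closure_inter_closure] at hj
  obtain ⟨z, hzO, hz⟩ := mem_closure_iff_nhds.1 hj.1 _ hO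
  obtain ⟨z', hzO', hz'⟩ := mem_closure_iff_nhds.1 hj.2 _ hO
  exact hz' ((h.mem_iff j hp z' hzO').2 ((h.mem_iff j hp z hzO).1 hz))

end

/-! ### Charts that display the covering as half spaces -/

section

variable {n : ℕ} {Y : Type u} [TopologicalSpace Y]

lemma tendsto_chart_symm_line {φ : OpenPartialHomeomorph Y (EuclideanQuadrant n)}
    {y : Y} (hy : y ∈ φ.source) (d : EuclideanSpace ℝ (Fin n)) :
    Filter.Tendsto (fun t : ℝ => φ.symm ((cornerModel n).symm ((φ y).1 + t • d))) (𝓝 0) (𝓝 y) := by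
  have h1 : Filter.Tendsto (fun t : ℝ => (cornerModel n).symm ((φ y).1 + t • d)) (𝓝 0)
      (𝓝 (φ y)) := by
    have h2 : Continuous fun t : ℝ => (cornerModel n).symm ((φ y).1 + t • d) :=
      (cornerModel n).continuous_symm.comp (by fun_prop)
    have h3 := h2.tendsto 0
    have h4 : (cornerModel n).symm ((φ y).1 + (0 : ℝ) • d) = φ y := by
      rw [zero_smul, add_zero]
      exact (cornerModel n).left_inv _
    rwa [h4] at h3
  have h5 : Filter.Tendsto φ.symm (𝓝 (φ y)) (𝓝 y) := by
    have := (φ.symm.continuousAt (φ.map_source hy)).tendsto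
    rwa [φ.left_inv hy] at this
  exact h5.comp h1

/-- In a chart, one can move those of finitely many coordinates that have given positive values in
prescribed directions. -/
lemma exists_chart_perturbation {φ : OpenPartialHomeomorph Y (EuclideanQuadrant n)} {ι : Type*}
    [Finite ι] {a : ι → Fin n} (ha : Function.Injective a) {c : ι → ℝ} (hc : ∀ j, 0 < c j)
    {y : Y} (hy : y ∈ φ.source) {N : Set Y} (hN : N ∈ 𝓝 y) (s : ι → ℝ) :
    ∃ z ∈ φ.source ∩ N, ∃ t : ℝ, 0 < t ∧ ∀ j, ((φ y).1 (a j) = c j → (φ z).1 (a j) = c j + t * s j) ∧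
      ((φ y).1 (a j) ≠ c j → (φ z).1 (a j) = (φ y).1 (a j)) := by
  classical
  -- Only coordinates exactly on their wall move, so inequalities that are already strict are
  -- untouched.
  let d : EuclideanSpace ℝ (Fin n) := WithLp.toLp 2
    (Function.extend a (fun j => if (φ y).1 (a j) = c j then s j else 0) 0)
  have hd : ∀ j, d (a j) = if (φ y).1 (a j) = c j then s j else 0 := fun j =>
    ha.extend_apply (fun j => if (φ y).1 (a j) = c j then s j else 0) (0 : Fin n → ℝ) j
  have hd' : ∀ i ∉ range a, d i = 0 := fun i hi =>
    Function.extend_apply' (fun j => if (φ y).1 (a j) = c j then s j else 0) (0 : Fin n → ℝ) i hi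
  have h1 : ∀ᶠ t : ℝ in 𝓝 0, (cornerModel n).symm ((φ y).1 + t • d) ∈ φ.target := by
    have h2 : Continuous fun t : ℝ => (cornerModel n).symm ((φ y).1 + t • d) :=
      (cornerModel n).continuous_symm.comp (by fun_prop)
    refine h2.continuousAt.eventually_mem (φ.open_target.mem_nhds ?_)
    rw [zero_smul, add_zero, show (cornerModel n).symm (φ y).1 = φ y from (cornerModel n).left_inv _]
    exact φ.map_source hy
  -- Inside the quadrant nothing is clamped. Moving coordinates start at `c j > 0`, and all others
  -- are constant.
  have h2 : ∀ᶠ t : ℝ in 𝓝 0, ∀ i, 0 ≤ ((φ y).1 + t • d) i := by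
    rw [Filter.eventually_all]
    intro i
    by_cases hi : i ∈ range a
    · obtain ⟨j, rfl⟩ := hi
      by_cases hj : (φ y).1 (a j) = c j
      · have h3 : Continuous fun t : ℝ => ((φ y).1 + t • d) (a j) := by
          simp only [PiLp.add_apply, PiLp.smul_apply]
          fun_prop
        refine (h3.continuousAt.eventually_mem (Ioi_mem_nhds (a := 0) ?_)).mono fun t ht => le_of_lt ht
        simpa [hj] using hc j
      · refine Filter.Eventually.of_forall fun t => ?_
        simpa [hd, hj] using (φ y).2 (a j)
    · refine Filter.Eventually.of_forall fun t => ?_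
      simpa [hd' i hi] using (φ y).2 i
  have h3 := tendsto_chart_symm_line hy d hN
  have h4 : ∀ᶠ t : ℝ in 𝓝[>] 0, 0 < t := self_mem_nhdsWithin
  obtain ⟨t, ⟨⟨ht1, ht2⟩, ht3⟩, ht4⟩ :=
    ((((h1.and h2).and h3).filter_mono nhdsWithin_le_nhds).and h4).exists
  set x := (cornerModel n).symm ((φ y).1 + t • d) with hx
  have hxv : (φ (φ.symm x)).1 = (φ y).1 + t • d := by
    rw [φ.right_inv ht1]
    exact (cornerModel n).right_inv (mem_range_cornerModel.2 ht2)
  refine ⟨φ.symm x, ⟨φ.map_target ht1, ht3⟩, t, ht4, fun j => ⟨fun hj => ?_, fun hj => ?_⟩⟩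
  · rw [hxv]
    simp [hd, hj]
  · rw [hxv]
    simp [hd, hj]

/-- The preimage of a convex set under a chart whose image is the part of the quadrant in a ball is
connected. -/
lemma isPreconnected_chart_preimage {φ : OpenPartialHomeomorph Y (EuclideanQuadrant n)}
    {x : EuclideanSpace ℝ (Fin n)} {ρ : ℝ} (hφ : φ.target = {z | z.1 ∈ Metric.ball x ρ})
    {C : Set (EuclideanSpace ℝ (Fin n))} (hC : Convex ℝ C) :
    IsPreconnected (φ.source ∩ {y | (φ y).1 ∈ C}) := by
  have h1 : Convex ℝ (C ∩ (Metric.ball x ρ ∩ range (cornerModel n))) :=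
    hC.inter ((convex_ball x ρ).inter (cornerModel n).convex_range)
  have h2 : φ.source ∩ {y | (φ y).1 ∈ C} = (fun z => φ.symm ((cornerModel n).symm z)) ''
      (C ∩ (Metric.ball x ρ ∩ range (cornerModel n))) := by
    ext y
    constructor
    · rintro ⟨hy, hyC⟩
      refine ⟨(φ y).1, ⟨hyC, ?_, ⟨φ y, rfl⟩⟩, ?_⟩
      · have := φ.map_source hy
        rwa [hφ] at this
      · change φ.symm ((cornerModel n).symm (cornerModel n (φ y))) = y
        rw [(cornerModel n).left_inv, φ.left_inv hy]
    · rintro ⟨z, ⟨hzC, hzb, w, rfl⟩, rfl⟩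
      have hw : w ∈ φ.target := by rw [hφ]; exact hzb
      simp only [(cornerModel n).left_inv]
      refine ⟨φ.map_target hw, ?_⟩
      rw [mem_ofPred_eq, φ.right_inv hw]
      exact hzC
  rw [h2]
  refine h1.isPreconnected.image _ (φ.continuousOn_symm.comp
    (cornerModel n).continuous_symm.continuousOn ?_)
  rintro z ⟨-, hzb, w, rfl⟩
  rw [(cornerModel n).left_inv, hφ]
  exact hzb

/-- Near each point `p` there is a chart in which the members of a regular covering with `p` in
their boundary are coordinate half spaces, and whose domain is an adapted neighbourhood. -/
theorem IsRegularCovering.exists_adapted_chart [ChartedSpace (EuclideanQuadrant n) Y]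
    [IsManifold (cornerModel n) ∞ Y] {J : Type}
    [Finite J] {U : J → Set Y} (hU : IsRegularCovering n U) (p : Y) :
    ∃ φ ∈ IsManifold.maximalAtlas (cornerModel n) ∞ Y, IsAdaptedNhd U p φ.source ∧
      ∃ a : {j // p ∈ frontier (U j)} → Fin n, Function.Injective a ∧
        (∀ j, 0 < (φ p).1 (a j)) ∧
        (∀ (j : {j // p ∈ frontier (U j)}), ∀ y ∈ φ.source,
          (y ∈ closure (U j) ↔ (φ p).1 (a j) ≤ (φ y).1 (a j)) ∧
          (y ∉ U j ↔ (φ y).1 (a j) ≤ (φ p).1 (a j))) := by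
  classical
  obtain ⟨φ, hφ, hp, a, ha, hc, hUa, hUn, ρ, hρ, hφt⟩ := hU.exists_chart p
  have hcl : ∀ (j : {j // p ∈ frontier (U j)}), ∀ y ∈ φ.source,
      y ∈ closure (U j) ↔ (φ p).1 (a j) ≤ (φ y).1 (a j) := by
    intro j y hy
    constructor
    · intro h
      by_contra hlt
      rw [not_le] at hlt
      have hcont : ContinuousAt (fun y => (φ y).1 (a j)) y :=
        (((EuclideanSpace.proj (𝕜 := ℝ) (a j)).continuous.comp
          continuous_subtype_val).continuousAt (x := φ y)).comp (φ.continuousAt hy)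
      have h1 := Filter.inter_mem (hcont.eventually_lt continuousAt_const hlt)
        (φ.open_source.mem_nhds hy)
      obtain ⟨z, ⟨hz1, hz2⟩, hzU⟩ := mem_closure_iff_nhds.1 h _ h1
      exact absurd ((hUa j z hz2).1 hzU) (not_lt.2 (le_of_lt hz1))
    · intro h
      rw [mem_closure_iff_nhds]
      intro N hN
      -- Pushing in the positive direction moves a point on the wall into `U j`.
      obtain ⟨z, ⟨hzs, hzN⟩, t, ht, hz⟩ := exists_chart_perturbation ha hc hy hN fun _ => 1
      refine ⟨z, hzN, (hUa j z hzs).2 ?_⟩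
      by_cases hj : (φ y).1 (a j) = (φ p).1 (a j)
      · rw [(hz j).1 hj]
        linarith
      · rw [(hz j).2 hj]
        exact lt_of_le_of_ne h (Ne.symm hj)
  have hni : ∀ (j : {j // p ∈ frontier (U j)}), ∀ y ∈ φ.source,
      y ∉ U j ↔ (φ y).1 (a j) ≤ (φ p).1 (a j) := fun j y hy => by rw [hUa j y hy, not_lt]
  have hfr : ∀ (j : {j // p ∈ frontier (U j)}), ∀ y ∈ φ.source,
      y ∈ frontier (U j) ↔ (φ y).1 (a j) = (φ p).1 (a j) := by
    intro j y hy
    rw [(hU.isOpen j).frontier_eq, mem_sdiff, hcl j y hy, hni j y hy, le_antisymm_iff, and_comm]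
  have hfn : ∀ j, p ∉ frontier (U j) → ∀ y ∈ φ.source, y ∉ frontier (U j) := by
    intro j hj y hy h
    have hO := φ.open_source.mem_nhds hy
    rw [frontier_eq_closure_inter_closure] at h
    obtain ⟨z, hzO, hz⟩ := mem_closure_iff_nhds.1 h.1 _ hO
    obtain ⟨z', hzO', hz'⟩ := mem_closure_iff_nhds.1 h.2 _ hO
    exact hz' ((hUn j hj z' hzO').2 ((hUn j hj z hzO).1 hz))
  -- One condition for each coordinate `a j`, a point or an open half-line; this is where convexity
  -- comes from.
  have hcell : ∀ K L : Finset J, (∀ j ∈ K, p ∈ frontier (U j)) → Disjoint K L →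
      IsAdjacent U p L → ∀ y ∈ φ.source, y ∈ openCell U K L ↔ ∀ j : {j // p ∈ frontier (U j)},
        (φ y).1 (a j) ∈ if j.1 ∈ K then {(φ p).1 (a j)} else
          if j.1 ∈ L then Ioi ((φ p).1 (a j)) else Iio ((φ p).1 (a j)) := by
    intro K L hK hKL hL y hy
    constructor
    · rintro ⟨h1, h2⟩ j
      split_ifs with hjK hjL
      · exact (hfr j y hy).1 ((h1 j).2 hjK)
      · exact (hUa j y hy).1 ((h2 j).2 hjL)
      · exact lt_of_le_of_ne ((hni j y hy).1 fun h => hjL ((h2 j).1 h))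
          fun h => hjK ((h1 j).1 ((hfr j y hy).2 h))
    · intro h
      refine ⟨fun j => ?_, fun j => ?_⟩
      · by_cases hj : p ∈ frontier (U j)
        · have := h ⟨j, hj⟩
          rw [hfr ⟨j, hj⟩ y hy]
          split_ifs at this with hjK hjL
          · exact iff_of_true this hjK
          · exact iff_of_false (ne_of_gt this) hjK
          · exact iff_of_false (ne_of_lt this) hjK
        · exact iff_of_false (hfn j hj y hy) fun h => hj (hK j h)
      · by_cases hj : p ∈ frontier (U j)
        · have := h ⟨j, hj⟩
          rw [hUa ⟨j, hj⟩ y hy]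
          split_ifs at this with hjK hjL
          · exact iff_of_false (not_lt.2 (le_of_eq this)) (Finset.disjoint_left.1 hKL hjK)
          · exact iff_of_true this hjL
          · exact iff_of_false (not_lt.2 (le_of_lt this)) hjL
        · rw [hUn j hj y hy, hL j hj]
  have hclosure : ∀ K L : Finset J, (∀ j ∈ K, p ∈ frontier (U j)) → Disjoint K L →
      IsAdjacent U p L → weakCell U K L ∩ φ.source ⊆ closure (openCell U K L ∩ φ.source) := by
    rintro K L hK hKL hL y ⟨⟨h1, h2, h3⟩, hy⟩
    rw [mem_closure_iff_nhds]
    intro N hN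
    -- Speed `0` stays on the walls of `K`, while `1` and `-1` make the other weak inequalities
    -- strict.
    obtain ⟨z, ⟨hzs, hzN⟩, t, ht, hz⟩ := exists_chart_perturbation ha hc hy hN
      fun j => if j.1 ∈ K then 0 else if j.1 ∈ L then 1 else -1
    refine ⟨z, hzN, (hcell K L hK hKL hL z hzs).2 fun j => ?_, hzs⟩
    obtain ⟨hz1, hz2⟩ := hz j
    split_ifs at hz1 ⊢ with hjK hjL
    · rw [mem_singleton_iff, hz1 ((hfr j y hy).1 (h1 j hjK))]
      ring
    · rw [mem_Ioi]
      have h4 := (hcl j y hy).1 (h2 j hjL)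
      by_cases hj : (φ y).1 (a j) = (φ p).1 (a j)
      · rw [hz1 hj]; linarith
      · rw [hz2 hj]; exact lt_of_le_of_ne h4 (Ne.symm hj)
    · rw [mem_Iio]
      have h4 := (hni j y hy).1 (h3 j hjL)
      by_cases hj : (φ y).1 (a j) = (φ p).1 (a j)
      · rw [hz1 hj]; linarith
      · rw [hz2 hj]; exact lt_of_le_of_ne h4 hj
  refine ⟨φ, hφ, ⟨φ.open_source, hp, hUn, fun K L hK hKL hL => ⟨?_, ?_⟩, hclosure⟩, a, ha, hc,
    fun j y hy => ⟨hcl j y hy, hni j y hy⟩⟩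
  -- `p` satisfies all the weak inequalities, so it is a limit of points of the cell.
  · rw [← closure_nonempty_iff]
    exact ⟨p, hclosure K L hK hKL hL ⟨hL.mem_weakCell hU.isOpen hK, hp⟩⟩
  · have hC : Convex ℝ (⋂ j : {j // p ∈ frontier (U j)},
        (EuclideanSpace.proj (𝕜 := ℝ) (a j) : EuclideanSpace ℝ (Fin n) →L[ℝ] ℝ) ⁻¹'
          (if j.1 ∈ K then {(φ p).1 (a j)} else
          if j.1 ∈ L then Ioi ((φ p).1 (a j)) else Iio ((φ p).1 (a j)))) := by
      refine convex_iInter fun j => Convex.linear_preimage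
        (f := (EuclideanSpace.proj (𝕜 := ℝ) (a j) : EuclideanSpace ℝ (Fin n) →L[ℝ] ℝ).toLinearMap) ?_
      split_ifs
      · exact convex_singleton _
      · exact convex_Ioi _
      · exact convex_Iio _
    convert! isPreconnected_chart_preimage hφt hC using 1
    ext y
    rw [inter_comm]
    refine and_congr_right fun hy => ?_
    rw [hcell K L hK hKL hL y hy, mem_ofPred_eq, mem_iInter]
    rfl

end

/-! ### The blocks of the partition -/

open Classical in
/-- The indices `j` such that `p` lies in `U j`. -/
noncomputable def memberIndices {Y : Type u} {J : Type} [Fintype J] (U : J → Set Y) (p : Y) :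
    Finset J :=
  {j | p ∈ U j}

lemma mem_memberIndices {Y : Type u} {J : Type} [Fintype J] {U : J → Set Y} {p : Y} {j : J} :
    j ∈ memberIndices U p ↔ p ∈ U j := by
  simp [memberIndices]

section

variable {Y : Type u} [TopologicalSpace Y] {J : Type} {U : J → Set Y}

lemma mem_coverBlock_iff {i : BlockIndex U} {y : Y} :
    y ∈ coverBlock U i ↔ ∃ h : y ∈ cell U i.1, ConnectedComponents.mk (⟨y, h⟩ : cell U i.1) = i.2 := by
  simp [coverBlock]

lemma coverBlock_subset_cell (i : BlockIndex U) : coverBlock U i ⊆ cell U i.1 := fun _ hy =>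
  (mem_coverBlock_iff.1 hy).1

lemma coverBlock_injOn {i i' : BlockIndex U} {y : Y} (hi : y ∈ coverBlock U i)
    (hi' : y ∈ coverBlock U i') (h : i.1 = i'.1) : i = i' := by
  obtain ⟨A, c⟩ := i
  obtain ⟨A', c'⟩ := i'
  obtain rfl : A = A' := h
  obtain ⟨_, h1⟩ := mem_coverBlock_iff.1 hi
  obtain ⟨_, h2⟩ := mem_coverBlock_iff.1 hi'
  rw [Sigma.mk.injEq]
  exact ⟨rfl, heq_of_eq (h1.symm.trans h2)⟩

lemma exists_mem_coverBlock {A : Finset J} {y : Y} (hy : y ∈ cell U A) :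
    ∃ i : BlockIndex U, i.1 = A ∧ y ∈ coverBlock U i :=
  ⟨⟨A, ConnectedComponents.mk ⟨y, hy⟩⟩, rfl, mem_coverBlock_iff.2 ⟨hy, rfl⟩⟩

lemma coverBlock_eq_connectedComponent (i : BlockIndex U) (y : cell U i.1) (hy : y.1 ∈ coverBlock U i) :
    coverBlock U i = Subtype.val '' connectedComponent y := by
  obtain ⟨_, hy'⟩ := mem_coverBlock_iff.1 hy
  rw [coverBlock, ← hy']
  congr 1
  ext z
  exact ConnectedComponents.coe_eq_coe'

lemma isConnected_coverBlock (i : BlockIndex U) : IsConnected (coverBlock U i) := by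
  obtain ⟨y, hy⟩ := ConnectedComponents.surjective_coe i.2
  have hy' : y.1 ∈ coverBlock U i := ⟨y, hy, rfl⟩
  rw [coverBlock_eq_connectedComponent i y hy']
  exact isConnected_connectedComponent.image _ continuous_subtype_val.continuousOn

lemma isClosed_coverBlock (i : BlockIndex U) : IsClosed (coverBlock U i) := by
  obtain ⟨y, hy⟩ := ConnectedComponents.surjective_coe i.2
  have hy' : y.1 ∈ coverBlock U i := ⟨y, hy, rfl⟩
  rw [coverBlock_eq_connectedComponent i y hy']
  exact (isClosed_closure : IsClosed (cell U i.1)).isClosedMap_subtype_val _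
    isClosed_connectedComponent

lemma subset_coverBlock {i : BlockIndex U} {S : Set Y} (hS : IsPreconnected S)
    (hSc : S ⊆ cell U i.1) {y : Y} (hyS : y ∈ S) (hy : y ∈ coverBlock U i) :
    S ⊆ coverBlock U i := by
  rw [coverBlock_eq_connectedComponent i ⟨y, hSc hyS⟩ hy]
  have h1 : IsPreconnected (Subtype.val ⁻¹' S : Set (cell U i.1)) := by
    rw [← Topology.IsInducing.subtypeVal.isPreconnected_image, Subtype.image_preimage_coe,
      inter_eq_right.2 hSc]
    exact hS
  intro z hz
  exact ⟨⟨z, hSc hz⟩, h1.subset_connectedComponent hyS hz, rfl⟩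

lemma cell_subset_weakCell (hU : ∀ j, IsOpen (U j)) (L : Finset J) : cell U L ⊆ weakCell U ∅ L := by
  intro y hy
  refine ⟨fun j hj => by simp at hj, fun j hj => closure_mono (fun z hz => (hz j).2 hj) hy,
    fun j hj => ?_⟩
  have : cell U L ⊆ (U j)ᶜ :=
    closure_minimal (fun z hz h => hj ((hz j).1 h)) (hU j).isClosed_compl
  exact this hy

lemma coverBlock_subset_compl (hU : ∀ j, IsOpen (U j)) {i : BlockIndex U} {j : J}
    (hj : j ∉ i.1) : coverBlock U i ⊆ (U j)ᶜ := fun _ hy =>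
  (cell_subset_weakCell hU _ (coverBlock_subset_cell i hy)).2.2 j hj

lemma coverBlock_subset_closure (hU : ∀ j, IsOpen (U j)) {i : BlockIndex U} {j : J}
    (hj : j ∈ i.1) : coverBlock U i ⊆ closure (U j) := fun _ hy =>
  (cell_subset_weakCell hU _ (coverBlock_subset_cell i hy)).2.1 j hj

/-- Needed to find a second index where `s j` is inserted, so that the nonvanishing of `s j` on
overlaps applies. -/
lemma nonempty_of_mem_coverBlock (hU : ⋃ j, U j = univ) {i : BlockIndex U} {y : Y}
    (hy : y ∈ coverBlock U i) : i.1.Nonempty := by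
  have h := coverBlock_subset_cell i hy
  obtain ⟨z, hz⟩ := closure_nonempty_iff.1 ⟨y, h⟩
  obtain ⟨j, hj⟩ := mem_iUnion.1 (hU ▸ mem_univ z)
  exact ⟨j, (hz j).1 hj⟩

lemma openCell_subset (K L : Finset J) : openCell U K L ⊆ {y | ∀ j, y ∈ U j ↔ j ∈ L} :=
  fun _ hy => hy.2

lemma mem_cell_of_forall {y : Y} {L : Finset J} (h : ∀ j, y ∈ U j ↔ j ∈ L) : y ∈ cell U L :=
  subset_closure h

/-! ### Blocks inside an adapted neighbourhood -/

namespace IsAdaptedNhd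

variable {p : Y} {O : Set Y} (hO : IsAdaptedNhd U p O)

include hO

lemma isAdjacent_of_mem_cell {y : Y} (hy : y ∈ O) {L : Finset J} (hyL : y ∈ cell U L) :
    IsAdjacent U p L := by
  obtain ⟨z, hzO, hz⟩ := mem_closure_iff_nhds.1 hyL _ (hO.isOpen.mem_nhds hy)
  intro j hj
  rw [← hz j, hO.mem_iff j hj z hzO]

lemma cell_inter (hU : ∀ j, IsOpen (U j)) {L : Finset J} (hL : IsAdjacent U p L) :
    cell U L ∩ O = weakCell U ∅ L ∩ O := by
  refine Subset.antisymm (inter_subset_inter_left _ (cell_subset_weakCell hU L)) ?_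
  intro y hy
  exact ⟨closure_mono (inter_subset_left.trans (openCell_subset ∅ L))
    (hO.closure ∅ L (by simp) (by simp) hL hy), hy.2⟩

/-- The set is squeezed between the connected set `openCell U ∅ L ∩ O` and its closure. -/
lemma isPreconnected_cell_inter (hU : ∀ j, IsOpen (U j)) {L : Finset J} (hL : IsAdjacent U p L) :
    IsPreconnected (cell U L ∩ O) := by
  rw [hO.cell_inter hU hL]
  refine (hO.connected ∅ L (by simp) (by simp) hL).isPreconnected.subset_closure ?_
    (hO.closure ∅ L (by simp) (by simp) hL)
  rintro y ⟨hy, hyO⟩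
  rw [← hO.cell_inter hU hL]
  exact ⟨subset_closure hy.2, hyO⟩

lemma mem_cell (hU : ∀ j, IsOpen (U j)) {L : Finset J} (hL : IsAdjacent U p L) : p ∈ cell U L := by
  have : p ∈ weakCell U ∅ L ∩ O := ⟨hL.mem_weakCell hU (by simp), hO.mem⟩
  rw [← hO.cell_inter hU hL] at this
  exact this.1

/-- `cell U i.1 ∩ O` is connected and contains `p`, so it lies in a single component: only blocks
through `p` reach `O`. -/
lemma mem_coverBlock (hU : ∀ j, IsOpen (U j)) {i : BlockIndex U}
    (h : (coverBlock U i ∩ O).Nonempty) : p ∈ coverBlock U i := by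
  obtain ⟨y, hyi, hy⟩ := h
  have hL := hO.isAdjacent_of_mem_cell hy (coverBlock_subset_cell i hyi)
  exact subset_coverBlock (hO.isPreconnected_cell_inter hU hL) inter_subset_left
    ⟨coverBlock_subset_cell i hyi, hy⟩ hyi ⟨hO.mem_cell hU hL, hO.mem⟩

lemma coverBlock_inter (hU : ∀ j, IsOpen (U j)) {i : BlockIndex U} (hi : p ∈ coverBlock U i) :
    coverBlock U i ∩ O = weakCell U ∅ i.1 ∩ O := by
  have hL := hO.isAdjacent_of_mem_cell hO.mem (coverBlock_subset_cell i hi)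
  rw [← hO.cell_inter hU hL]
  refine Subset.antisymm (inter_subset_inter_left _ (coverBlock_subset_cell i)) fun y hy =>
    ⟨?_, hy.2⟩
  exact subset_coverBlock (hO.isPreconnected_cell_inter hU hL) inter_subset_left
    ⟨hO.mem_cell hU hL, hO.mem⟩ hi hy

lemma isAdjacent_of_mem_coverBlock {i : BlockIndex U} (hi : p ∈ coverBlock U i) :
    IsAdjacent U p i.1 :=
  hO.isAdjacent_of_mem_cell hO.mem (coverBlock_subset_cell i hi)

end IsAdaptedNhd

end

/-! ### Standard form and regularity of the partition -/

section

variable {n : ℕ} {Y : Type u} [TopologicalSpace Y] [ChartedSpace (EuclideanQuadrant n) Y]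

/-- The codimension at a point of a regular partition is determined by the number of blocks at the
point. -/
lemma IsStandardNear.card_eq {ι : Type w} {block : ι → Set Y} {k : ℕ} {p : Y}
    (h : IsStandardNear n block k p) : Nat.card {i // p ∈ block i} = 2 ^ k := by
  obtain ⟨φ, -, hp, K, b, hK, hb, -, hblock, hrange⟩ := h
  have h1 : ∀ i, p ∈ block i ↔ i ∈ range b := by
    intro i
    refine ⟨fun hi => hrange i ⟨p, hi, hp⟩, ?_⟩
    rintro ⟨σ, rfl⟩
    have : p ∈ block (b σ) ∩ φ.source := by
      rw [hblock]
      exact ⟨hp, fun a => by simp⟩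
    exact this.1
  rw [Nat.card_congr ((Equiv.subtypeEquivRight h1).trans (Equiv.ofInjective b hb).symm)]
  simp [hK]

lemma IsStandardNear.unique {ι : Type w} {block : ι → Set Y} {k k' : ℕ} {p : Y}
    (h : IsStandardNear n block k p) (h' : IsStandardNear n block k' p) : k = k' :=
  Nat.pow_right_injective le_rfl (h.card_eq.symm.trans h'.card_eq)

variable {J : Type} {U : J → Set Y}

open Classical in
/-- The indices `j` such that `p` lies in the boundary of `U j`. -/
noncomputable def frontierIndices [Fintype J] (U : J → Set Y) (p : Y) : Finset J :=
  {j | p ∈ frontier (U j)}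

lemma mem_frontierIndices [Fintype J] {p : Y} {j : J} :
    j ∈ frontierIndices U p ↔ p ∈ frontier (U j) := by
  simp [frontierIndices]

variable [IsManifold (cornerModel n) ∞ Y] [Fintype J]

lemma IsRegularCovering.exists_adaptedNhd (hU : IsRegularCovering n U) (p : Y) :
    ∃ O, IsAdaptedNhd U p O := by
  obtain ⟨φ, -, hO, -⟩ := hU.exists_adapted_chart p
  exact ⟨_, hO⟩

/-- The partition associated to a regular covering is standard near each point. -/
theorem IsRegularCovering.isStandardNear (hU : IsRegularCovering n U) (p : Y) :
    IsStandardNear n (coverBlock U) (frontierIndices U p).card p := by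
  classical
  obtain ⟨φ, hφ, hO, a, ha, hc, hUa⟩ := hU.exists_adapted_chart p
  let K : Finset (Fin n) := Finset.univ.image a
  have haK : ∀ j, a j ∈ K := fun j => Finset.mem_image_of_mem a (Finset.mem_univ j)
  -- Indices off the frontier are fixed by `p`; the signs decide the frontier indices.
  let A : (K → Bool) → Finset J := fun σ =>
    {j | (p ∉ frontier (U j) → p ∈ U j) ∧ ∀ h : p ∈ frontier (U j), σ ⟨a ⟨j, h⟩, haK _⟩ = true}
  have hA1 : ∀ σ (j : {j // p ∈ frontier (U j)}), j.1 ∈ A σ ↔ σ ⟨a j, haK j⟩ = true := by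
    rintro σ ⟨j, hj⟩
    simp [A, hj]
  have hA2 : ∀ σ, IsAdjacent U p (A σ) := by
    intro σ j hj
    simp [A, hj]
  choose b hb hbp using fun σ => exists_mem_coverBlock (hO.mem_cell hU.isOpen (hA2 σ))
  refine ⟨φ, hφ, hO.mem, K, b, ?_, ?_, ?_, ?_, ?_⟩
  · rw [Finset.card_image_of_injective _ ha, Finset.card_univ, Fintype.card_subtype]
    rfl
  · intro σ τ h
    funext ⟨x, hx⟩
    obtain ⟨j, -, rfl⟩ := Finset.mem_image.1 hx
    have := hA1 σ j
    rw [← hb, h, hb, hA1 τ j] at this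
    exact (Bool.eq_iff_iff.2 this).symm
  · intro x hx
    obtain ⟨j, -, rfl⟩ := Finset.mem_image.1 hx
    exact hc j
  · intro σ
    rw [hO.coverBlock_inter hU.isOpen (hbp σ), hb, inter_comm]
    ext y
    refine and_congr_right fun hy => ?_
    constructor
    · rintro ⟨-, h1, h2⟩ ⟨x, hx⟩
      obtain ⟨j, -, rfl⟩ := Finset.mem_image.1 hx
      split_ifs with hσ
      · exact (hUa j y hy).1.1 (h1 j ((hA1 σ j).2 hσ))
      · exact (hUa j y hy).2.1 (h2 j fun h => hσ ((hA1 σ j).1 h))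
    · intro h
      refine ⟨by simp, fun j hj => ?_, fun j hj => ?_⟩
      · by_cases hpj : p ∈ frontier (U j)
        · have := h ⟨a ⟨j, hpj⟩, haK _⟩
          rw [if_pos ((hA1 σ ⟨j, hpj⟩).1 hj)] at this
          exact (hUa ⟨j, hpj⟩ y hy).1.2 this
        · exact subset_closure ((hO.mem_iff j hpj y hy).2 ((hA2 σ j hpj).1 hj))
      · by_cases hpj : p ∈ frontier (U j)
        · have := h ⟨a ⟨j, hpj⟩, haK _⟩
          rw [if_neg fun h => hj ((hA1 σ ⟨j, hpj⟩).2 h)] at this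
          exact (hUa ⟨j, hpj⟩ y hy).2.2 this
        · exact fun hyj => hj ((hA2 σ j hpj).2 ((hO.mem_iff j hpj y hy).1 hyj))
  · intro i hi
    have hpi := hO.mem_coverBlock hU.isOpen hi
    have hL := hO.isAdjacent_of_mem_coverBlock hpi
    -- Adjacency determines `i.1` away from the frontier indices, so the signs read off on these
    -- recover the block.
    obtain ⟨σ, hσ⟩ : ∃ σ : K → Bool, ∀ j, σ ⟨a j, haK j⟩ = true ↔ j.1 ∈ i.1 := by
      refine ⟨fun x => decide (∃ j, a j = x.1 ∧ j.1 ∈ i.1), fun j => ?_⟩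
      rw [decide_eq_true_iff]
      constructor
      · rintro ⟨j', hj', hji⟩
        rwa [ha hj'] at hji
      · exact fun h => ⟨j, rfl, h⟩
    refine ⟨σ, coverBlock_injOn (hbp σ) hpi ?_⟩
    rw [hb]
    ext j
    by_cases hpj : p ∈ frontier (U j)
    · exact (hA1 σ ⟨j, hpj⟩).trans (hσ ⟨j, hpj⟩)
    · rw [hA2 _ j hpj, hL j hpj]

/-- The number of blocks at `p` determines `k`, so the stratum, defined by arbitrary charts, can be
computed in the adapted one. -/
lemma IsRegularCovering.mem_stratum_iff (hU : IsRegularCovering n U) {k : ℕ} {p : Y} :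
    p ∈ stratum n (coverBlock U) k ↔ (frontierIndices U p).card = k :=
  ⟨fun h => (hU.isStandardNear p).unique h, fun h => h ▸ hU.isStandardNear p⟩

/-- The partition associated to a regular covering is regular. -/
theorem IsRegularCovering.isRegularPartition (hU : IsRegularCovering n U) :
    IsRegularPartition n (coverBlock U) where
  connected := isConnected_coverBlock
  iUnion_eq := by
    rw [eq_univ_iff_forall]
    intro y
    obtain ⟨i, -, hi⟩ := exists_mem_coverBlock (U := U) (y := y) (A := memberIndices U y)
      (mem_cell_of_forall fun j => mem_memberIndices.symm)
    exact mem_iUnion.2 ⟨i, hi⟩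
  disjoint := by
    intro i i' hne
    rw [Set.disjoint_left]
    intro p hp hp'
    apply hne
    obtain ⟨O, hO⟩ := hU.exists_adaptedNhd p
    have hpi := interior_subset hp
    refine coverBlock_injOn hpi (interior_subset hp') ?_
    have hL := hO.isAdjacent_of_mem_coverBlock hpi
    -- Points off all frontiers with member indices `i.1` accumulate at `p`, so one lies in block
    -- `i'`; off the frontiers the weak conditions for `i'.1` are strict, which forces `i.1 = i'.1`.
    have h1 := hO.closure ∅ i.1 (by simp) (by simp) hL ⟨hL.mem_weakCell hU.isOpen (by simp), hO.mem⟩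
    obtain ⟨y, hy, hyc, -⟩ := mem_closure_iff_nhds.1 h1 _ (mem_interior_iff_mem_nhds.1 hp')
    obtain ⟨-, h2, h3⟩ := cell_subset_weakCell hU.isOpen _ (coverBlock_subset_cell i' hy)
    ext j
    rw [← hyc.2 j]
    refine ⟨fun h => by_contra fun h' => h3 j h' h, fun h => ?_⟩
    by_contra hyj
    have : y ∈ frontier (U j) := by
      rw [(hU.isOpen j).frontier_eq]
      exact ⟨h2 j h, hyj⟩
    simpa using (hyc.1 j).1 this
  regular p := ⟨_, hU.isStandardNear p⟩

end

/-! ### Facets of the partition -/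

section

variable {n : ℕ} {Y : Type u} [TopologicalSpace Y] {J : Type} {U : J → Set Y}

/-- Two points that have the same position with respect to all `U j` and to all blocks. -/
structure SamePosition (U : J → Set Y) (x y : Y) : Prop where
  frontier : ∀ j, x ∈ frontier (U j) ↔ y ∈ frontier (U j)
  mem : ∀ j, x ∈ U j ↔ y ∈ U j
  block : ∀ i, x ∈ coverBlock U i ↔ y ∈ coverBlock U i

lemma SamePosition.symm {x y : Y} (h : SamePosition U x y) : SamePosition U y x :=
  ⟨fun j => (h.frontier j).symm, fun j => (h.mem j).symm, fun i => (h.block i).symm⟩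

lemma SamePosition.trans {x y z : Y} (h : SamePosition U x y) (h' : SamePosition U y z) :
    SamePosition U x z :=
  ⟨fun j => (h.frontier j).trans (h'.frontier j), fun j => (h.mem j).trans (h'.mem j),
    fun i => (h.block i).trans (h'.block i)⟩

lemma SamePosition.isAdjacent {x y : Y} (h : SamePosition U x y) {L : Finset J}
    (hL : IsAdjacent U x L) : IsAdjacent U y L := fun j hj =>
  (hL j fun h' => hj ((h.frontier j).1 h')).trans (h.mem j)

lemma IsAdaptedNhd.coverBlock_of_isAdjacent {p : Y} {O : Set Y} (hO : IsAdaptedNhd U p O)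
    (hU : ∀ j, IsOpen (U j)) {y : Y} (hy : y ∈ O) {i : BlockIndex U} (hi : p ∈ coverBlock U i)
    (h : IsAdjacent U y i.1) : y ∈ coverBlock U i := by
  have : y ∈ weakCell U ∅ i.1 ∩ O := ⟨h.mem_weakCell hU (by simp), hy⟩
  rw [← hO.coverBlock_inter hU hi] at this
  exact this.1

/-- Near `p` the frontier indices form a subset of those of `p`; equal cardinality forces equality,
and all else follows. -/
lemma IsAdaptedNhd.samePosition [Fintype J] {p : Y} {O : Set Y} (hO : IsAdaptedNhd U p O)
    (hU : ∀ j, IsOpen (U j)) {y : Y} (hy : y ∈ O)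
    (hcard : (frontierIndices U y).card = (frontierIndices U p).card) : SamePosition U p y := by
  have hsub : frontierIndices U y ⊆ frontierIndices U p := fun j hj =>
    mem_frontierIndices.2 (hO.mem_frontier hy (mem_frontierIndices.1 hj))
  have heq := Finset.eq_of_subset_of_card_le hsub hcard.ge
  have h1 : ∀ j, p ∈ frontier (U j) ↔ y ∈ frontier (U j) := fun j => by
    rw [← mem_frontierIndices, ← heq, mem_frontierIndices]
  have h2 : ∀ j, p ∈ U j ↔ y ∈ U j := by
    intro j
    by_cases hj : p ∈ frontier (U j)
    · exact iff_of_false (notMem_of_mem_frontier (hU j) hj)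
        (notMem_of_mem_frontier (hU j) ((h1 j).1 hj))
    · exact (hO.mem_iff j hj y hy).symm
  refine ⟨h1, h2, fun i => ⟨fun hi => ?_, fun hi => hO.mem_coverBlock hU ⟨y, hi, hy⟩⟩⟩
  refine hO.coverBlock_of_isAdjacent hU hy hi fun j hj => ?_
  rw [hO.isAdjacent_of_mem_coverBlock hi j fun h => hj ((h1 j).1 h), h2]

variable [ChartedSpace (EuclideanQuadrant n) Y] [IsManifold (cornerModel n) ∞ Y] [Fintype J]

namespace IsRegularCovering

lemma isAdjacent_of_mem_coverBlock (hU : IsRegularCovering n U) {p : Y} {i : BlockIndex U}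
    (hi : p ∈ coverBlock U i) : IsAdjacent U p i.1 := by
  obtain ⟨O, hO⟩ := hU.exists_adaptedNhd p
  exact hO.isAdjacent_of_mem_coverBlock hi

lemma exists_coverBlock (hU : IsRegularCovering n U) {p : Y} {L : Finset J}
    (hL : IsAdjacent U p L) : ∃ i : BlockIndex U, i.1 = L ∧ p ∈ coverBlock U i := by
  obtain ⟨O, hO⟩ := hU.exists_adaptedNhd p
  exact exists_mem_coverBlock (hO.mem_cell hU.isOpen hL)

/-- On a stratum the number of frontier indices is constant, so position is locally constant there,
hence constant on a connected component. -/
lemma samePosition_of_mem (hU : IsRegularCovering n U) {k : ℕ} {p y : Y}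
    (hy : y ∈ connectedComponentIn (stratum n (coverBlock U) k) p) : SamePosition U p y := by
  have hp : p ∈ stratum n (coverBlock U) k := by
    by_contra h
    rw [connectedComponentIn_eq_empty h] at hy
    exact hy
  refine isPreconnected_connectedComponentIn.induction₂
    (s := connectedComponentIn (stratum n (coverBlock U) k) p) (SamePosition U) ?_ ?_ ?_
    (mem_connectedComponentIn hp) hy
  · intro x hx
    obtain ⟨O, hO⟩ := hU.exists_adaptedNhd x
    filter_upwards [mem_nhdsWithin_of_mem_nhds (hO.isOpen.mem_nhds hO.mem), self_mem_nhdsWithin]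
      with z hz hzC
    refine hO.samePosition hU.isOpen hz ?_
    rw [hU.mem_stratum_iff.1 (connectedComponentIn_subset _ _ hzC),
      hU.mem_stratum_iff.1 (connectedComponentIn_subset _ _ hx)]
  · intro x y z _ _ _ h h'
    exact h.trans h'
  · intro x y _ _ h
    exact h.symm

/-- The position of a facet with respect to the blocks is that of any point of the component of the
stratum that it is the closure of. -/
lemma facet_subset_coverBlock_iff (hU : IsRegularCovering n U) {k : ℕ} {p : Y}
    (hp : p ∈ stratum n (coverBlock U) k) {i : BlockIndex U} :
    closure (connectedComponentIn (stratum n (coverBlock U) k) p) ⊆ coverBlock U i ↔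
      p ∈ coverBlock U i :=
  ⟨fun h => h (subset_closure (mem_connectedComponentIn hp)), fun h =>
    closure_minimal (fun _ hy => ((hU.samePosition_of_mem hy).block i).1 h)
      (isClosed_coverBlock i)⟩

lemma facet_subset_frontier_iff (hU : IsRegularCovering n U) {k : ℕ} {p : Y}
    (hp : p ∈ stratum n (coverBlock U) k) {j : J} :
    closure (connectedComponentIn (stratum n (coverBlock U) k) p) ⊆ frontier (U j) ↔
      p ∈ frontier (U j) :=
  ⟨fun h => h (subset_closure (mem_connectedComponentIn hp)), fun h =>
    closure_minimal (fun _ hy => ((hU.samePosition_of_mem hy).frontier j).1 h) isClosed_frontier⟩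

/-- Each facet is contained in facets of lower codimension in all possible positions. -/
theorem exists_facet_superset (hU : IsRegularCovering n U) {k : ℕ} {p : Y}
    (hp : p ∈ stratum n (coverBlock U) k) {K L : Finset J} (hK : ∀ j ∈ K, p ∈ frontier (U j))
    (hKL : Disjoint K L) (hL : IsAdjacent U p L) :
    ∃ q ∈ stratum n (coverBlock U) K.card, q ∈ openCell U K L ∧
      closure (connectedComponentIn (stratum n (coverBlock U) k) p) ⊆
        closure (connectedComponentIn (stratum n (coverBlock U) K.card) q) ∧
      ∀ i, p ∈ coverBlock U i → IsAdjacent U q i.1 → q ∈ coverBlock U i := by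
  obtain ⟨O, hO⟩ := hU.exists_adaptedNhd p
  obtain ⟨q, hqc, hqO⟩ := (hO.connected K L hK hKL hL).nonempty
  have hcell : openCell U K L ⊆ stratum n (coverBlock U) K.card := by
    intro y hy
    rw [hU.mem_stratum_iff]
    congr 1
    ext j
    rw [mem_frontierIndices, hy.1]
  set D := connectedComponentIn (stratum n (coverBlock U) K.card) q with hD
  have hqD : q ∈ D := mem_connectedComponentIn (hcell hqc)
  have hDcell : D ⊆ openCell U K L := by
    intro y hy
    have h := hU.samePosition_of_mem hy
    exact ⟨fun j => by rw [← h.frontier, hqc.1], fun j => by rw [← h.mem, hqc.2]⟩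
  -- If `D` meets `O'`, it contains the connected set `openCell U K L ∩ O'`, whose closure contains
  -- every point of `O'` in the position of `p`.
  have hlocal : ∀ x O', SamePosition U p x → IsAdaptedNhd U x O' → (D ∩ O').Nonempty →
      ∀ y ∈ O', SamePosition U p y → y ∈ closure D := by
    rintro x O' hx hO' ⟨z, hzD, hzO⟩ y hyO hy
    have hK' : ∀ j ∈ K, x ∈ frontier (U j) := fun j hj => (hx.frontier j).1 (hK j hj)
    have hL' := hx.isAdjacent hL
    have h1 : openCell U K L ∩ O' ⊆ D := by
      rw [hD, connectedComponentIn_eq hzD]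
      exact (hO'.connected K L hK' hKL hL').isPreconnected.subset_connectedComponentIn
        ⟨hDcell hzD, hzO⟩ (inter_subset_left.trans hcell)
    refine closure_mono h1 (hO'.closure K L hK' hKL hL' ⟨?_, hyO⟩)
    exact (hy.isAdjacent hL).mem_weakCell hU.isOpen fun j hj => (hy.frontier j).1 (hK j hj)
  have hpp : SamePosition U p p := hU.samePosition_of_mem (mem_connectedComponentIn hp)
  refine ⟨q, hcell hqc, hqc, ?_, fun i hi hq => hO.coverBlock_of_isAdjacent hU.isOpen hqO hi hq⟩
  refine closure_minimal (fun y hy => ?_) isClosed_closure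
  -- By `hlocal`, used in both directions, lying in `closure D` is locally constant along the
  -- component of `p`.
  have h1 : p ∈ closure D ↔ y ∈ closure D := by
    refine isPreconnected_connectedComponentIn.induction₂
      (s := connectedComponentIn (stratum n (coverBlock U) k) p)
      (fun x y => x ∈ closure D ↔ y ∈ closure D) ?_ (fun x y z _ _ _ h h' => h.trans h')
      (fun x y _ _ h => h.symm) (mem_connectedComponentIn hp) hy
    intro x hx
    obtain ⟨O', hO'⟩ := hU.exists_adaptedNhd x
    filter_upwards [mem_nhdsWithin_of_mem_nhds (hO'.isOpen.mem_nhds hO'.mem), self_mem_nhdsWithin]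
      with z hz hzC
    have hx' := hU.samePosition_of_mem hx
    have hz' := hU.samePosition_of_mem hzC
    have hne : ∀ w ∈ O', w ∈ closure D → (D ∩ O').Nonempty := by
      intro w hw hwD
      rw [inter_comm]
      exact mem_closure_iff_nhds.1 hwD _ (hO'.isOpen.mem_nhds hw)
    exact ⟨fun h => hlocal x O' hx' hO' (hne x hO'.mem h) z hz hz',
      fun h => hlocal x O' hx' hO' (hne z hz h) x hO'.mem hx'⟩
  exact h1.1 (hlocal p O hpp hO ⟨q, hqD, hqO⟩ p hO.mem hpp)

/-- At a frontier point of `U j`, the cell that omits all frontier indices accumulates; its points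
are outside `U j` and off its frontier, so outside its closure. -/
lemma interior_closure_subset (hU : IsRegularCovering n U) (j : J) :
    interior (closure (U j)) ⊆ U j := by
  intro p hp
  by_contra hpj
  have hpf : p ∈ frontier (U j) := by
    rw [(hU.isOpen j).frontier_eq]
    exact ⟨interior_subset hp, hpj⟩
  obtain ⟨O, hO⟩ := hU.exists_adaptedNhd p
  have hL : IsAdjacent U p (memberIndices U p) := fun j _ => mem_memberIndices
  obtain ⟨y, hy, hyc, -⟩ := mem_closure_iff_nhds.1 (hO.closure ∅ _ (by simp) (by simp) hL
    ⟨hL.mem_weakCell hU.isOpen (by simp), hO.mem⟩) _ (mem_interior_iff_mem_nhds.1 hp)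
  have hyj : y ∉ U j := by rwa [hyc.2, mem_memberIndices]
  have : y ∈ frontier (U j) := by
    rw [(hU.isOpen j).frontier_eq]
    exact ⟨hy, hyj⟩
  simpa using (hyc.1 j).1 this

lemma interior_coverBlock_subset (hU : IsRegularCovering n U) {i : BlockIndex U} {j : J}
    (hj : j ∈ i.1) : interior (coverBlock U i) ⊆ U j :=
  (interior_mono (coverBlock_subset_closure hU.isOpen hj)).trans (hU.interior_closure_subset j)

end IsRegularCovering

end

/-! ### Clutching quivers of the local tensorial system -/

/-- In a quiver whose vertices are the subsets of `K`, with an edge from `A` to `A ∪ {j}` for each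
`j ∈ K \ A`, there is a path between any two comparable vertices. -/
lemma nonempty_edgePath_of_subset {V : Type w} {E : V → V → Prop} {J : Type} [DecidableEq J]
    {K : Finset J} (v : {A : Finset J // A ⊆ K} → V)
    (h : ∀ A B, (∃ j ∈ K, j ∉ A.1 ∧ B.1 = insert j A.1) → E (v A) (v B))
    (A B : {A : Finset J // A ⊆ K}) (hAB : A.1 ⊆ B.1) : Nonempty (EdgePath E (v A) (v B)) := by
  let _ : Quiver V := ⟨fun x y => PLift (E x y)⟩
  -- The elements of `B \ A` are added one at a time.
  have key : ∀ s : Finset J, Disjoint A.1 s → ∀ hs : A.1 ∪ s ⊆ K,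
      Nonempty (Quiver.Path (v A) (v ⟨A.1 ∪ s, hs⟩)) := by
    intro s
    induction s using Finset.induction_on with
    | empty =>
      intro _ hs
      have : (⟨A.1 ∪ ∅, hs⟩ : {A : Finset J // A ⊆ K}) = A := Subtype.ext (Finset.union_empty _)
      rw [this]
      exact ⟨Quiver.Path.nil⟩
    | insert j s hj ih =>
      intro hd hs
      rw [Finset.disjoint_insert_right] at hd
      rw [Finset.union_insert] at hs
      obtain ⟨p⟩ := ih hd.2 ((Finset.subset_insert _ _).trans hs)
      refine ⟨p.cons (PLift.up (h _ _ ⟨j, hs (Finset.mem_insert_self _ _), ?_,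
        Finset.union_insert _ _ _⟩))⟩
      simp [hd.1, hj]
  have hB : A.1 ∪ (B.1 \ A.1) = B.1 := Finset.union_sdiff_of_subset hAB
  obtain ⟨p⟩ := key (B.1 \ A.1) Finset.disjoint_sdiff (by rw [hB]; exact B.2)
  have : (⟨A.1 ∪ (B.1 \ A.1), by rw [hB]; exact B.2⟩ : {A : Finset J // A ⊆ K}) = B :=
    Subtype.ext hB
  rw [this] at p
  exact ⟨p⟩

/-- The directed cube of the subsets of `K` has a unique source and a unique sink, and each vertex
lies on a path from the source to the sink. -/
lemma exists_source_sink_of_cube {V : Type w} {E : V → V → Prop} {J : Type} [DecidableEq J]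
    {K : Finset J} (v : {A : Finset J // A ⊆ K} ≃ V)
    (h : ∀ A B, E (v A) (v B) ↔ ∃ j ∈ K, j ∉ A.1 ∧ B.1 = insert j A.1) :
    ∃ a b, (∀ i, (∀ i', ¬ E i' i) ↔ i = a) ∧ (∀ i, (∀ i', ¬ E i i') ↔ i = b) ∧
      ∀ i, Nonempty (EdgePath E a i) ∧ Nonempty (EdgePath E i b) := by
  have hpath := nonempty_edgePath_of_subset v fun A B => (h A B).2
  refine ⟨v ⟨∅, Finset.empty_subset K⟩, v ⟨K, subset_rfl⟩, ?_, ?_, ?_⟩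
  · rw [v.forall_congr_right.symm]
    intro A
    rw [v.forall_congr_right.symm, v.apply_eq_iff_eq, Subtype.ext_iff]
    simp only [h]
    constructor
    · intro hA
      rw [Finset.eq_empty_iff_forall_notMem]
      intro j hj
      exact hA ⟨A.1.erase j, (Finset.erase_subset _ _).trans A.2⟩
        ⟨j, A.2 hj, Finset.notMem_erase _ _, (Finset.insert_erase hj).symm⟩
    · rintro hA B ⟨j, -, -, hj⟩
      rw [hA] at hj
      exact Finset.insert_ne_empty _ _ hj.symm
  · rw [v.forall_congr_right.symm]
    intro A
    rw [v.forall_congr_right.symm, v.apply_eq_iff_eq, Subtype.ext_iff]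
    simp only [h]
    constructor
    · intro hA
      refine Finset.Subset.antisymm A.2 fun j hj => ?_
      by_contra hjA
      exact hA ⟨insert j A.1, Finset.insert_subset hj A.2⟩ ⟨j, hj, hjA, rfl⟩
    · rintro hA B ⟨j, hj, hjA, -⟩
      exact hjA (by rwa [hA])
  · rw [v.forall_congr_right.symm]
    exact fun A => ⟨hpath _ _ (Finset.empty_subset _), hpath _ _ A.2⟩

section

variable {n : ℕ} {Y : Type u} [TopologicalSpace Y] [ChartedSpace (EuclideanQuadrant n) Y]
  {J : Type} [DecidableEq J] {U : J → Set Y}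

lemma SeedSystem.edge_iff (S : SeedSystem.{u, v} n U) {Z : Set Y} {i i' : BlockIndex U} :
    S.localTensorialSystem.edge Z i i' ↔ ∃ W, IsFacet n (coverBlock U) 1 W ∧ Z ⊆ W ∧
      W ⊆ coverBlock U i ∧ W ⊆ coverBlock U i' ∧ ∃ j, j ∉ i.1 ∧ i'.1 = insert j i.1 := Iff.rfl

variable [IsManifold (cornerModel n) ∞ Y] [Fintype J]

/-- The edges of a clutching quiver `Q_Z`. -/
theorem SeedSystem.edge_facet_iff (S : SeedSystem.{u, v} n U) (hU : IsRegularCovering n U) {k : ℕ}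
    {p : Y} (hp : p ∈ stratum n (coverBlock U) k) {i i' : BlockIndex U} :
    S.localTensorialSystem.edge
        (closure (connectedComponentIn (stratum n (coverBlock U) k) p)) i i' ↔
      p ∈ coverBlock U i ∧ p ∈ coverBlock U i' ∧
        ∃ j, p ∈ frontier (U j) ∧ j ∉ i.1 ∧ i'.1 = insert j i.1 := by
  rw [S.edge_iff]
  constructor
  · rintro ⟨W, -, hZW, hi, hi', j, hj, hji⟩
    have hpi := (hU.facet_subset_coverBlock_iff hp).1 (hZW.trans hi)
    have hpi' := (hU.facet_subset_coverBlock_iff hp).1 (hZW.trans hi')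
    refine ⟨hpi, hpi', j, ?_, hj, hji⟩
    -- Off the frontier, membership of `j` in an adjacent index set is decided by `p`, so `i` and
    -- `i'` could not differ at `j`.
    by_contra hpj
    apply hj
    rw [hU.isAdjacent_of_mem_coverBlock hpi j hpj, ← hU.isAdjacent_of_mem_coverBlock hpi' j hpj,
      hji]
    exact Finset.mem_insert_self _ _
  · rintro ⟨hpi, hpi', j, hpj, hj, hji⟩
    have hL := hU.isAdjacent_of_mem_coverBlock hpi
    -- The face with `j` as its only frontier index, lying on the side of block `i` for every other
    -- index.
    obtain ⟨q, hq, hqc, hsub, hqb⟩ := hU.exists_facet_superset hp (K := {j}) (L := i.1)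
      (by simpa using hpj) (by simpa using hj) hL
    rw [Finset.card_singleton] at hq hsub
    refine ⟨_, ⟨q, hq, rfl⟩, hsub, (hU.facet_subset_coverBlock_iff hq).2 (hqb i hpi ?_),
      (hU.facet_subset_coverBlock_iff hq).2 (hqb i' hpi' ?_), j, hj, hji⟩
    · exact fun j' _ => (hqc.2 j').symm
    · intro j' hj'
      have : j' ≠ j := by
        rintro rfl
        exact hj' ((hqc.1 j').2 (Finset.mem_singleton_self _))
      rw [hji, hqc.2, Finset.mem_insert, or_iff_right this]

/-- Each edge of a clutching quiver along a facet of codimension `k ≥ 2` comes from a facet of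
codimension `k - 1`. -/
theorem SeedSystem.quiver_eq_preQuiver (S : SeedSystem.{u, v} n U) (hU : IsRegularCovering n U)
    {k : ℕ} (hk : 2 ≤ k) {Z : Set Y} (hZ : IsFacet n (coverBlock U) k Z) :
    S.localTensorialSystem.quiver Z = S.localTensorialSystem.preQuiver k Z := by
  obtain ⟨p, hp, rfl⟩ := hZ
  ext ⟨i, hi⟩ ⟨i', hi'⟩
  constructor
  · intro h
    obtain ⟨hpi, hpi', j, hpj, hj, hji⟩ := (S.edge_facet_iff hU hp).1 h
    have hcard := hU.mem_stratum_iff.1 hp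
    -- As `k ≥ 2`, an index other than `j` can be released: moving off its wall to the side of block
    -- `i` leads to codimension `k - 1` and keeps the edge in direction `j`.
    obtain ⟨j₁, hj₁, hne⟩ : ∃ j₁ ∈ frontierIndices U p, j₁ ≠ j :=
      Finset.exists_mem_ne (by omega) j
    let K := (frontierIndices U p).erase j₁
    have hjK : j ∈ K := Finset.mem_erase.2 ⟨hne.symm, mem_frontierIndices.2 hpj⟩
    have hKp : ∀ j ∈ K, p ∈ frontier (U j) := fun j hj =>
      mem_frontierIndices.1 (Finset.mem_of_mem_erase hj)
    have hL : IsAdjacent U p (i.1 \ K) := by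
      intro j' hj'
      rw [Finset.mem_sdiff, and_iff_left fun h => hj' (hKp _ h),
        hU.isAdjacent_of_mem_coverBlock hpi j' hj']
    obtain ⟨q, hq, hqc, hsub, hqb⟩ := hU.exists_facet_superset hp hKp Finset.disjoint_sdiff hL
    have hKc : K.card = k - 1 := by rw [Finset.card_erase_of_mem hj₁, hcard]
    rw [hKc] at hq hsub
    have hqi : IsAdjacent U q i.1 := by
      intro j' hj'
      rw [hqc.2, Finset.mem_sdiff, and_iff_left fun h => hj' ((hqc.1 j').2 h)]
    have hqi' : IsAdjacent U q i'.1 := by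
      intro j' hj'
      have : j' ≠ j := by
        rintro rfl
        exact hj' ((hqc.1 j').2 hjK)
      rw [hji, Finset.mem_insert, or_iff_right this, hqi j' hj']
    exact ⟨_, ⟨q, hq, rfl⟩, hsub, (S.edge_facet_iff hU hq).2
      ⟨hqb i hpi hqi, hqb i' hpi' hqi', j, (hqc.1 j).2 hjK, hj, hji⟩⟩
  -- Every edge is witnessed by a codimension-one face, and a face containing `W` contains `Z`.
  · rintro ⟨W, -, hZW, W', hW', hWW', h⟩
    exact ⟨W', hW', hZW.trans hWW', h⟩

/-- The clutching quiver along a facet is a directed cube. -/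
theorem SeedSystem.exists_cube (S : SeedSystem.{u, v} n U) (hU : IsRegularCovering n U)
    {k : ℕ} {Z : Set Y} (hZ : IsFacet n (coverBlock U) k Z) :
    ∃ (K J₀ : Finset J) (v : {A : Finset J // A ⊆ K} ≃ {i // Z ⊆ coverBlock U i}),
      K.card = k ∧ (∀ j, j ∈ K ↔ Z ⊆ frontier (U j)) ∧
      Disjoint J₀ K ∧ (∀ A, (v A).1.1 = J₀ ∪ A.1) ∧
      ∀ A B, S.localTensorialSystem.quiver Z (v A) (v B) ↔
        ∃ j ∈ K, j ∉ A.1 ∧ B.1 = insert j A.1 := by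
  obtain ⟨p, hp, rfl⟩ := hZ
  set Z := closure (connectedComponentIn (stratum n (coverBlock U) k) p)
  set K := frontierIndices U p
  set J₀ := memberIndices U p
  have hdisj : Disjoint J₀ K := by
    rw [Finset.disjoint_left]
    intro j hj hjK
    exact notMem_of_mem_frontier (hU.isOpen j) (mem_frontierIndices.1 hjK) (mem_memberIndices.1 hj)
  have hadj : ∀ A : {A : Finset J // A ⊆ K}, IsAdjacent U p (J₀ ∪ A.1) := by
    intro A j hj
    rw [Finset.mem_union, mem_memberIndices, or_iff_left fun h => hj (mem_frontierIndices.1 (A.2 h))]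
  choose v hv hpv using fun A => hU.exists_coverBlock (hadj A)
  have hunion : ∀ A B : {A : Finset J // A ⊆ K}, J₀ ∪ A.1 = J₀ ∪ B.1 → A = B := by
    intro A B h
    have h' : ∀ A : {A : Finset J // A ⊆ K}, (J₀ ∪ A.1) \ J₀ = A.1 := fun A => by
      rw [Finset.union_sdiff_left, Finset.sdiff_eq_self_iff_disjoint]
      exact (hdisj.mono_right A.2).symm
    exact Subtype.ext (by rw [← h' A, h, h' B])
  let e : {A : Finset J // A ⊆ K} ≃ {i // Z ⊆ coverBlock U i} := Equiv.ofBijective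
    (fun A => ⟨v A, (hU.facet_subset_coverBlock_iff hp).2 (hpv A)⟩) (by
      constructor
      · intro A B h
        apply hunion
        rw [← hv, ← hv, show v A = v B from congrArg Subtype.val h]
      · rintro ⟨i, hi⟩
        have hpi := (hU.facet_subset_coverBlock_iff hp).1 hi
        have hL := hU.isAdjacent_of_mem_coverBlock hpi
        -- Adjacency forces `i.1 \ K = J₀`, and two blocks at `p` with the same index set coincide.
        refine ⟨⟨i.1 ∩ K, Finset.inter_subset_right⟩, Subtype.ext (coverBlock_injOn (hpv _) hpi ?_)⟩
        rw [hv]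
        ext j
        by_cases hj : p ∈ frontier (U j)
        · have hjK : j ∈ K := mem_frontierIndices.2 hj
          simp [hjK, Finset.disjoint_right.1 hdisj hjK]
        · rw [Finset.mem_union, Finset.mem_inter, mem_memberIndices, hL j hj,
            or_iff_left_of_imp fun h => h.1])
  have he : ∀ A, (e A).1.1 = J₀ ∪ A.1 := hv
  refine ⟨K, J₀, e, hU.mem_stratum_iff.1 hp, fun j => ?_, hdisj, he, fun A B => ?_⟩
  · rw [hU.facet_subset_frontier_iff hp, mem_frontierIndices]
  · refine (S.edge_facet_iff hU hp).trans ?_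
    rw [he, he]
    constructor
    · rintro ⟨-, -, j, hj, hjA, hAB⟩
      have hjK : j ∈ K := mem_frontierIndices.2 hj
      refine ⟨j, hjK, fun h => hjA (Finset.mem_union_right _ h), ?_⟩
      have := hunion B ⟨insert j A.1, Finset.insert_subset hjK A.2⟩
        (hAB.trans (Finset.union_insert _ _ _).symm)
      rw [this]
    · rintro ⟨j, hj, hjA, hAB⟩
      refine ⟨hpv A, hpv B, j, mem_frontierIndices.1 hj, ?_, ?_⟩
      · rw [Finset.mem_union, not_or]
        exact ⟨Finset.disjoint_right.1 hdisj hj, hjA⟩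
      · rw [hAB, Finset.union_insert]

end

/-! ### Insertion of tensor factors -/

section

variable {J : Type} [DecidableEq J] {M : J → Type v} [∀ j, AddCommGroup (M j)]
  [∀ j, Module ℂ (M j)] {A B C : Finset J}

lemma tensorInsert_tprod (hAB : A ⊆ B) (s : ∀ j, M j) (m : ∀ j : A, M j) :
    tensorInsert hAB s (⨂ₜ[ℂ] j : A, m j) = ⨂ₜ[ℂ] j : B, Function.updateFinset s A m j := by
  simp [tensorInsert]

lemma tensorInsert_refl (s : ∀ j, M j) : tensorInsert (subset_refl A) s = LinearMap.id := by
  apply PiTensorProduct.ext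
  ext m
  simp only [LinearMap.compMultilinearMap_apply, LinearMap.id_apply]
  rw [tensorInsert_tprod]
  congr 1
  funext j
  simp [Function.updateFinset]

lemma tensorInsert_comp (hAB : A ⊆ B) (hBC : B ⊆ C) (s : ∀ j, M j) :
    tensorInsert hBC s ∘ₗ tensorInsert hAB s = tensorInsert (hAB.trans hBC) s := by
  apply PiTensorProduct.ext
  ext m
  simp only [LinearMap.compMultilinearMap_apply, LinearMap.comp_apply]
  rw [tensorInsert_tprod, tensorInsert_tprod, tensorInsert_tprod]
  congr 1
  funext j
  by_cases hB : j.1 ∈ B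
  · simp [Function.updateFinset, hB]
  · have hA : j.1 ∉ A := fun h => hB (hAB h)
    simp [Function.updateFinset, hA, hB]

/-- Used to exchange the sections for smooth extensions that agree with them only over the closures
of the `U j`. -/
lemma tensorInsert_congr (hAB : A ⊆ B) {s s' : ∀ j, M j} (h : ∀ j ∈ B, j ∉ A → s j = s' j) :
    tensorInsert hAB s = tensorInsert hAB s' := by
  apply PiTensorProduct.ext
  ext m
  simp only [LinearMap.compMultilinearMap_apply]
  rw [tensorInsert_tprod, tensorInsert_tprod]
  congr 1
  funext j
  by_cases hA : j.1 ∈ A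
  · simp [Function.updateFinset, hA]
  · simp [Function.updateFinset, hA, h j.1 j.2 hA]

/-- The insertion of a nonzero tensor factor is injective. -/
lemma tensorInsert_injective (hAB : A ⊆ B) {j : J} (hj : j ∉ A) (hB : B = insert j A)
    {s : ∀ j, M j} (hs : s j ≠ 0) : Function.Injective (tensorInsert hAB s) := by
  obtain ⟨f, hf⟩ : ∃ f : M j →ₗ[ℂ] ℂ, f (s j) ≠ 0 := by
    by_contra! h
    exact hs ((Module.forall_dual_apply_eq_zero_iff ℂ (s j)).1 h)
  have hjB : j ∈ B := hB ▸ Finset.mem_insert_self j A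
  have hupd : ∀ [DecidableEq B] [DecidableEq A] (m : ∀ i : B, M i) (i : B) (x : M i) (hi : i.1 ∈ A),
      (fun a : A => Function.update m i x ⟨a, hAB a.2⟩) =
        Function.update (fun a : A => m ⟨a, hAB a.2⟩) ⟨i.1, hi⟩ x := by
    intro _ _ m i x hi
    funext a
    by_cases ha : a = ⟨i.1, hi⟩
    · subst ha
      simp
    · have : (⟨a, hAB a.2⟩ : B) ≠ i := by
        rintro rfl
        exact ha rfl
      rw [Function.update_of_ne ha, Function.update_of_ne this]
  have hupd' : ∀ [DecidableEq B] (m : ∀ i : B, M i) (x : M j),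
      (fun a : A => Function.update m ⟨j, hjB⟩ x ⟨a, hAB a.2⟩) = fun a : A => m ⟨a, hAB a.2⟩ := by
    intro _ m x
    funext a
    refine Function.update_of_ne ?_ _ _
    intro h
    have h' : a.1 = j := congrArg Subtype.val h
    exact hj (h' ▸ a.2)
  have hcases : ∀ i : B, i.1 ∈ A ∨ i = ⟨j, hjB⟩ := by
    rintro ⟨i, hi⟩
    rw [hB, Finset.mem_insert] at hi
    rcases hi with rfl | hi
    · exact .inr rfl
    · exact .inl hi
  -- Contraction of the slot `j` with `f`; it inverts the insertion up to the nonzero scalar `f (s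
  -- j)`.
  let G : MultilinearMap ℂ (fun i : B => M i) (⨂[ℂ] i : A, M i) :=
    { toFun := fun m => f (m ⟨j, hjB⟩) • ⨂ₜ[ℂ] a : A, m ⟨a, hAB a.2⟩
      map_update_add' := by
        intro _ m i x y
        rcases hcases i with hi | rfl
        · have hij : (⟨j, hjB⟩ : B) ≠ i := by
            rintro rfl
            exact hj hi
          simp only [Function.update_of_ne hij, hupd m i _ hi, MultilinearMap.map_update_add, smul_add]
        · simp only [Function.update_self, hupd', map_add, add_smul]
      map_update_smul' := by
        intro _ m i c x
        rcases hcases i with hi | rfl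
        · have hij : (⟨j, hjB⟩ : B) ≠ i := by
            rintro rfl
            exact hj hi
          simp only [Function.update_of_ne hij, hupd m i _ hi, MultilinearMap.map_update_smul,
            smul_comm c]
        · simp only [Function.update_self, hupd', map_smul, smul_assoc] }
  have hG : PiTensorProduct.lift G ∘ₗ tensorInsert hAB s = f (s j) • LinearMap.id := by
    apply PiTensorProduct.ext
    ext m
    simp only [LinearMap.compMultilinearMap_apply, LinearMap.comp_apply, LinearMap.smul_apply,
      LinearMap.id_apply]
    rw [tensorInsert_tprod, PiTensorProduct.lift.tprod]
    change f (Function.updateFinset s A m j) •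
      (⨂ₜ[ℂ] a : A, Function.updateFinset s A m (a : J)) = _
    have h1 : Function.updateFinset s A m j = s j := by simp [Function.updateFinset, hj]
    have h2 : (fun a : A => Function.updateFinset s A m (a : J)) = m := by
      funext a
      simp [Function.updateFinset]
    rw [h1, h2]
  intro x y hxy
  have h1 := congrArg (PiTensorProduct.lift G) hxy
  rw [← LinearMap.comp_apply, ← LinearMap.comp_apply, hG] at h1
  exact smul_right_injective _ hf h1

end

/-! ### Smooth sections -/

namespace SmoothBundle

variable {n : ℕ} {Y : Type u} [TopologicalSpace Y] [ChartedSpace (EuclideanQuadrant n) Y]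

lemma IsSmoothSection.mono {E : SmoothBundle.{u, v} n Y} {V V' : Opens Y} (h : V' ≤ V)
    {t : ∀ y, E.fiber y} (ht : E.IsSmoothSection V t) : E.IsSmoothSection V' t := by
  refine ⟨h.trans ht.1, fun e he => ?_⟩
  obtain ⟨c, hc, hct⟩ := ht.2 e he
  have hsub : (V' ∩ e.dom : Set Y) ⊆ V ∩ e.dom := inter_subset_inter_left _ h
  exact ⟨c, fun a => (hc a).mono hsub, fun y hy => hct y (hsub hy)⟩

lemma isSmoothSection_frame (E : SmoothBundle.{u, v} n Y) {e : LocalFrame E.fiber}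
    (he : e ∈ E.frames) (a : e.idx) : E.IsSmoothSection e.dom (e.vec a) := by
  refine ⟨E.frames_le e he, fun e' he' => ?_⟩
  obtain ⟨g, hg, hgv⟩ := E.compat e he e' he'
  exact ⟨g a, hg a, fun y hy => hgv y hy a⟩

/-- Some coordinate in a frame is nonzero at `y` and stays so nearby by continuity; independence of
the frame does the rest. -/
lemma IsSmoothSection.eventually_ne_zero {E : SmoothBundle.{u, v} n Y} {V : Opens Y}
    {t : ∀ y, E.fiber y} (ht : E.IsSmoothSection V t) {y : Y} (hy : y ∈ V) (hty : t y ≠ 0) :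
    ∀ᶠ z in 𝓝 y, t z ≠ 0 := by
  obtain ⟨e, he, hye⟩ := E.cover y (ht.1 hy)
  obtain ⟨c, hc, hct⟩ := ht.2 e he
  have hopen : (V ∩ e.dom : Set Y) ∈ 𝓝 y :=
    Filter.inter_mem (V.isOpen.mem_nhds hy) (e.dom.isOpen.mem_nhds hye)
  obtain ⟨a, ha⟩ : ∃ a, c a y ≠ 0 := by
    by_contra! h
    apply hty
    rw [hct y ⟨hy, hye⟩]
    simp [h]
  have hcont := (hc a).continuousOn.continuousAt hopen
  filter_upwards [hcont.eventually_ne ha, hopen] with z hz hzV h0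
  rw [hct z hzV] at h0
  exact hz (Fintype.linearIndependent_iff.1 (e.indep z hzV.2) _ h0 a)

lemma mem_tensor_base {J : Type} [DecidableEq J] (H : J → SmoothBundle.{u, v} n Y) (A : Finset J)
    {y : Y} : y ∈ (tensor H A).base ↔ ∀ j ∈ A, y ∈ (H j).base := by
  simp [tensor, ← SetLike.mem_coe, Opens.coe_finset_inf]

lemma mem_tensor_dom {J : Type} [DecidableEq J] {H : J → SmoothBundle.{u, v} n Y} {A : Finset J}
    {e : ∀ j : A, LocalFrame (H j).fiber} {y : Y} :
    y ∈ (LocalFrame.tensor (E := fun j => (H j).fiber) A e).dom ↔ ∀ j : A, y ∈ (e j).dom := by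
  simp [LocalFrame.tensor, ← SetLike.mem_coe, Opens.coe_finset_inf]

/-- Tensor products of smooth sections are smooth. -/
lemma isSmoothSection_tprod {J : Type} [DecidableEq J] (H : J → SmoothBundle.{u, v} n Y)
    (A : Finset J) {V : Opens Y} {t : ∀ j : A, ∀ y, (H j).fiber y} (hV : V ≤ (tensor H A).base)
    (ht : ∀ j : A, (H j).IsSmoothSection V (t j)) :
    (tensor H A).IsSmoothSection V (fun y => ⨂ₜ[ℂ] j : A, t j y) := by
  refine ⟨hV, ?_⟩
  rintro _ ⟨e, he, rfl⟩
  choose c hc hct using fun j : A => (ht j).2 _ (he j)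
  have hsub : ∀ j : A, (V ∩ (LocalFrame.tensor (E := fun j => (H j).fiber) A e).dom : Set Y) ⊆
      V ∩ (e j).dom := fun j y hy => ⟨hy.1, mem_tensor_dom.1 hy.2 j⟩
  refine ⟨fun b y => ∏ j : A, c j (b j) y, fun b => ?_, fun y hy => ?_⟩
  · have h0 : ContDiff ℝ ∞ fun x : A → ℂ => ∏ j, x j :=
      contDiff_prod fun j _ => contDiff_apply ℝ ℂ j
    exact h0.contMDiff.comp_contMDiffOn
      (contMDiffOn_pi_space.2 fun j => (hc j (b j)).mono (hsub j))
  · classical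
    have h1 : ∀ j : A, t j y = ∑ b, c j b y • (e j).vec b y := fun j => hct j y (hsub j hy)
    simp only [LocalFrame.tensor]
    simp_rw [h1, MultilinearMap.map_sum, MultilinearMap.map_smul_univ]
    congr!

/-- The insertion of smooth sections as tensor factors sends frames to smooth sections. -/
lemma isSmoothEmbedding_tensorInsert {J : Type} [DecidableEq J] (H : J → SmoothBundle.{u, v} n Y)
    {A B : Finset J} (hAB : A ⊆ B) {V : Opens Y} {t : ∀ j y, (H j).fiber y}
    (hV : V ≤ (tensor H B).base)
    (ht : ∀ j ∈ B, j ∉ A → (H j).IsSmoothSection V (t j))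
    (hinj : ∀ y ∈ V, Function.Injective (tensorInsert hAB fun j => t j y)) :
    (tensor H A).IsSmoothEmbedding (tensor H B) V (fun y => tensorInsert hAB fun j => t j y) := by
  refine ⟨fun y hy => (mem_tensor_base H A).2 fun j hj => (mem_tensor_base H B).1 (hV hy) j (hAB hj),
    hV, hinj, ?_⟩
  rintro _ ⟨e, he, rfl⟩ a
  -- The image of a frame member is a pure tensor of smooth sections: frame vectors in the slots of
  -- `A`, `t j` in the others.
  have h1 : (fun y => tensorInsert hAB (fun j => t j y)
      ((LocalFrame.tensor (E := fun j => (H j).fiber) A e).vec a y)) = fun y => ⨂ₜ[ℂ] j : B,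
        (if hj : j.1 ∈ A then fun y => (e ⟨j, hj⟩).vec (a ⟨j, hj⟩) y else t j) y := by
    funext y
    refine (tensorInsert_tprod hAB _ _).trans ?_
    congr 1
    funext j
    by_cases hj : j.1 ∈ A <;> simp [Function.updateFinset, hj]
  have h2 := isSmoothSection_tprod H B
    (V := V ⊓ (LocalFrame.tensor (E := fun j => (H j).fiber) A e).dom)
    (t := fun j => if hj : j.1 ∈ A then fun y => (e ⟨j, hj⟩).vec (a ⟨j, hj⟩) y else t j)
    (inf_le_left.trans hV) (by
      intro j
      by_cases hj : j.1 ∈ A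
      · simp only [hj, dif_pos]
        refine ((H j).isSmoothSection_frame (he ⟨j, hj⟩) (a ⟨j, hj⟩)).mono ?_
        exact fun y hy => mem_tensor_dom.1 hy.2 ⟨j, hj⟩
      · simp only [hj, dif_neg, not_false_eq_true]
        exact (ht j j.2 hj).mono inf_le_left)
  rw [← h1] at h2
  exact h2

end SmoothBundle

/-! ### Smoothness of the clutching maps -/

section

variable {n : ℕ} {Y : Type u} [TopologicalSpace Y] [ChartedSpace (EuclideanQuadrant n) Y]
  {J : Type} [DecidableEq J] {U : J → Set Y}

/-- The insertion of the section `s j` is a smooth bundle embedding near any set that lies in two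
blocks that differ by the index `j`. -/
theorem SeedSystem.isEmbeddingAround (S : SeedSystem.{u, v} n U) (hU : IsRegularCovering n U)
    {Z : Set Y} {i i' : BlockIndex U} (hi : Z ⊆ coverBlock U i) (hi' : Z ⊆ coverBlock U i') {j : J}
    (hj : j ∉ i.1) (hij : i'.1 = insert j i.1) (hsub : i.1 ⊆ i'.1) :
    (SmoothBundle.tensor S.H i.1).IsEmbeddingAround (SmoothBundle.tensor S.H i'.1) Z
      (fun y => tensorInsert hsub fun j => S.s j y) := by
  choose V hUV t ht hts using S.smooth
  have hji' : j ∈ i'.1 := hij ▸ Finset.mem_insert_self j i.1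
  have hunique : ∀ j' ∈ i'.1, j' ∉ i.1 → j' = j := by
    intro j' hj' hj'i
    rw [hij, Finset.mem_insert] at hj'
    exact hj'.resolve_right hj'i
  have hcl : ∀ j ∈ i'.1, Z ⊆ closure (U j) := fun j hj =>
    hi'.trans (coverBlock_subset_closure hU.isOpen hj)
  -- The extended insertion is injective where the smooth extension `t j` of `s j` does not vanish.
  let W : Opens Y := ⟨{y | y ∈ V j ∧ y ∈ (SmoothBundle.tensor S.H i'.1).base ∧ t j y ≠ 0}, by
    rw [isOpen_iff_mem_nhds]
    rintro y ⟨hyV, hyb, hy0⟩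
    filter_upwards [(V j).isOpen.mem_nhds hyV, (SmoothBundle.tensor S.H i'.1).base.isOpen.mem_nhds hyb,
      (ht j).eventually_ne_zero hyV hy0] with z h1 h2 h3 using ⟨h1, h2, h3⟩⟩
  refine ⟨W, ?_, fun y => tensorInsert hsub fun j => t j y, ?_, ?_⟩
  · intro y hy
    refine ⟨hUV j (hcl j hji' hy), (SmoothBundle.mem_tensor_base _ _).2 fun j' hj' =>
      S.closure_subset j' (hcl j' hj' hy), ?_⟩
    rw [hts j y (hcl j hji' hy)]
    refine S.ne_zero j y ⟨hcl j hji' hy, ?_⟩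
    obtain ⟨j', hj'⟩ := nonempty_of_mem_coverBlock hU.iUnion_eq (hi hy)
    exact mem_iUnion₂.2 ⟨j', fun h => hj (h ▸ hj'), hcl j' (hsub hj') hy⟩
  · refine SmoothBundle.isSmoothEmbedding_tensorInsert S.H hsub (fun y hy => hy.2.1) ?_ ?_
    · intro j' hj' hj'i
      obtain rfl := hunique j' hj' hj'i
      exact (ht j').mono fun y (hy : y ∈ W) => hy.1
    · exact fun y hy => tensorInsert_injective hsub hj hij hy.2.2
  · intro y hy
    exact tensorInsert_congr hsub fun j' hj' _ => hts j' y (hcl j' hj' hy)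

end

/-! ### The local tensorial system -/

section

variable {n : ℕ} {Y : Type u} [TopologicalSpace Y] [ChartedSpace (EuclideanQuadrant n) Y]
  {J : Type} [DecidableEq J] {U : J → Set Y}

/-- Composites of clutching maps of the local tensorial system insert the missing sections. -/
theorem SeedSystem.composite_eq (S : SeedSystem.{u, v} n U) {Z : Set Y}
    {i i' : {i // Z ⊆ coverBlock U i}} (p : EdgePath (S.localTensorialSystem.quiver Z) i i') :
    ∃ h : i.1.1 ⊆ i'.1.1, ∀ y,
      S.localTensorialSystem.composite Z y p = tensorInsert h (fun j => S.s j y) := by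
  induction p with
  | nil => exact ⟨subset_rfl, fun y => (tensorInsert_refl fun j => S.s j y).symm⟩
  | @cons b c p e ih =>
    obtain ⟨h, hp⟩ := ih
    have hbc : b.1.1 ⊆ c.1.1 := by
      obtain ⟨_, _, _, _, _, j, _, hj⟩ := e.down
      rw [hj]
      exact Finset.subset_insert j _
    refine ⟨h.trans hbc, fun y => ?_⟩
    refine Eq.trans ?_ (tensorInsert_comp h hbc fun j => S.s j y)
    rw [← hp y]
    rfl

variable [IsManifold (cornerModel n) ∞ Y] [Fintype J]

/-- The local tensorial system is a bundle settlement. -/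
theorem SeedSystem.isSettlement (S : SeedSystem.{u, v} n U) (hU : IsRegularCovering n U) :
    S.localTensorialSystem.IsSettlement where
  regular := hU.isRegularPartition
  block_subset i y hy := (SmoothBundle.mem_tensor_base S.H i.1).2 fun j hj =>
    S.closure_subset j (coverBlock_subset_closure hU.isOpen hj hy)
  edge_subset := by
    rintro k Z - - i i' ⟨W, -, hZW, hi, hi', -⟩
    exact ⟨hZW.trans hi, hZW.trans hi'⟩
  embedding := by
    rintro k Z - - i i' ⟨W, -, hZW, hi, hi', j, hj, hji⟩
    exact S.isEmbeddingAround hU (hZW.trans hi) (hZW.trans hi') hj hji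
      (hji ▸ Finset.subset_insert j i.1)
  face := by
    intro Z hZ
    refine ⟨?_, ?_⟩
    · rintro i ⟨W, -, -, -, -, j, hj, hji⟩
      exact hj (hji ▸ Finset.mem_insert_self j i.1)
    · intro i i' hne hi hi'
      obtain ⟨K, J₀, v, hK, -, -, -, hv⟩ := S.exists_cube hU hZ
      -- The cube has dimension one: two vertices, `∅` and `{j}`, and a single arrow between them.
      obtain ⟨j, rfl⟩ := Finset.card_eq_one.1 hK
      obtain ⟨A, hA⟩ := v.surjective ⟨i, hi⟩
      obtain ⟨B, hB⟩ := v.surjective ⟨i', hi'⟩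
      have h1 := hv A B
      have h2 := hv B A
      rw [hA, hB] at h1 h2
      change Xor (S.localTensorialSystem.quiver Z ⟨i, hi⟩ ⟨i', hi'⟩)
        (S.localTensorialSystem.quiver Z ⟨i', hi'⟩ ⟨i, hi⟩)
      rw [h1, h2]
      have hAB : A ≠ B := by
        rintro rfl
        exact hne (congrArg Subtype.val (hA.symm.trans hB))
      obtain ⟨A, hA'⟩ := A
      obtain ⟨B, hB'⟩ := B
      rcases Finset.subset_singleton_iff.1 hA' with rfl | rfl <;>
        rcases Finset.subset_singleton_iff.1 hB' with rfl | rfl <;> simp [Xor] at hAB ⊢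
  restrict := by
    rintro k Z - - W - hZW i i' ⟨W', hW', hWW', h⟩
    exact ⟨⟨W', hW', hZW.trans hWW', h⟩, fun _ _ => rfl⟩
  saturated := by
    intro k Z _ hZ
    obtain ⟨K, J₀, v, -, -, -, -, hv⟩ := S.exists_cube hU hZ
    obtain ⟨a, b, -, -, h⟩ := exists_source_sink_of_cube v hv
    exact ⟨b, fun i => (h i).2⟩
  terminal := fun k Z hk hZ _ => S.quiver_eq_preQuiver hU hk hZ
  consistent := by
    intro k Z _ _ i i' p q y _
    -- Both composites are the same insertion; comparing a loop with the empty path gives the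
    -- identity.
    obtain ⟨_, hp⟩ := S.composite_eq p
    obtain ⟨_, hq⟩ := S.composite_eq q
    rw [hp, hq]

end

theorem mainTheorem1 (n : ℕ) {Y : Type u} [TopologicalSpace Y] [T2Space Y] [ParacompactSpace Y]
    [ChartedSpace (EuclideanQuadrant n) Y] [IsManifold (cornerModel n) ∞ Y]
    {J : Type} [Fintype J] [DecidableEq J] (U : J → Set Y) (hU : IsRegularCovering n U)
    (S : SeedSystem.{u, v} n U) :
    -- the blocks `⨂_{j ∈ J(i)} H_j` with the clutching maps inserting `s_j` form a settlement
    S.localTensorialSystem.IsSettlement ∧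
    -- a face lies in the boundary of a unique `U j`; the direction is from outside to inside `U j`
    (∀ Z, IsFacet n (coverBlock U) 1 Z → ∃ j, (∀ j', Z ⊆ frontier (U j') ↔ j' = j) ∧
      ∀ i i', S.localTensorialSystem.edge Z i i' →
        j ∉ i.1 ∧ i'.1 = insert j i.1 ∧
        coverBlock U i ⊆ (U j)ᶜ ∧ interior (coverBlock U i') ⊆ U j) ∧
    ∀ k Z, IsFacet n (coverBlock U) k Z →
      -- the clutching quiver is the directed cube of the subsets of `K`, where `K` is the set of
      -- the `k` indices `j` such that `Z` lies in the boundary of `U j`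
      (∃ (K J₀ : Finset J) (v : {A : Finset J // A ⊆ K} ≃ {i // Z ⊆ coverBlock U i}),
        K.card = k ∧ (∀ j, j ∈ K ↔ Z ⊆ frontier (U j)) ∧
        Disjoint J₀ K ∧ (∀ A, (v A).1.1 = J₀ ∪ A.1) ∧
        ∀ A B, S.localTensorialSystem.quiver Z (v A) (v B) ↔
          ∃ j ∈ K, j ∉ A.1 ∧ B.1 = insert j A.1) ∧
      -- it has a unique source `a` and a unique sink `b`, and each vertex is on a path from `a`
      -- to `b`
      (∃ a b, (∀ i, (∀ i', ¬ S.localTensorialSystem.quiver Z i' i) ↔ i = a) ∧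
        (∀ i, (∀ i', ¬ S.localTensorialSystem.quiver Z i i') ↔ i = b) ∧
        ∀ i, Nonempty (EdgePath (S.localTensorialSystem.quiver Z) a i) ∧
          Nonempty (EdgePath (S.localTensorialSystem.quiver Z) i b)) ∧
      -- it is saturated, and so is the preliminary quiver, to which no clutching map is added
      IsSaturated (S.localTensorialSystem.quiver Z) ∧
      (2 ≤ k → IsSaturated (S.localTensorialSystem.preQuiver k Z) ∧
        S.localTensorialSystem.quiver Z = S.localTensorialSystem.preQuiver k Z) ∧
      -- the composite along a path only depends on its ends: it inserts the `s_j` that are missing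
      ∀ (i i' : {i // Z ⊆ coverBlock U i}) (p : EdgePath (S.localTensorialSystem.quiver Z) i i'),
        ∃ h : i.1.1 ⊆ i'.1.1, ∀ y ∈ Z,
          S.localTensorialSystem.composite Z y p = tensorInsert h (fun j => S.s j y) := by
  refine ⟨S.isSettlement hU, fun Z hZ => ?_, fun k Z hZ => ?_⟩
  · obtain ⟨K, J₀, v, hK, hKZ, hdisj, hv, hE⟩ := S.exists_cube hU hZ
    obtain ⟨j, rfl⟩ := Finset.card_eq_one.1 hK
    refine ⟨j, fun j' => by rw [← hKZ, Finset.mem_singleton], fun i i' h => ?_⟩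
    have hi : Z ⊆ coverBlock U i ∧ Z ⊆ coverBlock U i' := by
      obtain ⟨W, -, hZW, hi, hi', -⟩ := h
      exact ⟨hZW.trans hi, hZW.trans hi'⟩
    obtain ⟨A, hA⟩ := v.surjective ⟨i, hi.1⟩
    obtain ⟨B, hB⟩ := v.surjective ⟨i', hi.2⟩
    have h1 := hE A B
    rw [hA, hB] at h1
    obtain ⟨j', hj', hjA, hAB⟩ := h1.1 h
    obtain rfl := Finset.mem_singleton.1 hj'
    have hiA : i.1 = J₀ ∪ A.1 := by rw [← hv A, hA]
    have hiB : i'.1 = J₀ ∪ B.1 := by rw [← hv B, hB]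
    have hji : j' ∉ i.1 := by
      rw [hiA, Finset.mem_union, not_or]
      exact ⟨Finset.disjoint_singleton_right.1 hdisj, hjA⟩
    have hii' : i'.1 = insert j' i.1 := by rw [hiB, hAB, hiA, Finset.union_insert]
    exact ⟨hji, hii', coverBlock_subset_compl hU.isOpen hji,
      hU.interior_coverBlock_subset (hii' ▸ Finset.mem_insert_self j' i.1)⟩
  · obtain ⟨K, J₀, v, hK, hKZ, hdisj, hv, hE⟩ := S.exists_cube hU hZ
    obtain ⟨a, b, hab⟩ := exists_source_sink_of_cube v hE
    have hsat : IsSaturated (S.localTensorialSystem.quiver Z) := ⟨b, fun i => (hab.2.2 i).2⟩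
    refine ⟨⟨K, J₀, v, hK, hKZ, hdisj, hv, hE⟩, ⟨a, b, hab⟩, hsat, fun hk => ?_, fun i i' p => ?_⟩
    · have h := S.quiver_eq_preQuiver hU hk hZ
      exact ⟨h ▸ hsat, h⟩
    · obtain ⟨h, hp⟩ := S.composite_eq p
      exact ⟨h, fun y _ => hp y⟩
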